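/- Let $k$ be a perfect field. A $k$-variety is a reduced separated scheme of finite type over $k$ (not necessarily irreducible). Let $V$ be an irreducible $k$-variety, $W$ a $k$-variety, and $\pi : W \to V$ an abelian covering with Galois group $\mathfrak g$: that is, $\mathfrak g$ is a finite abelian group acting faithfully on $W$ by automorphisms over $V$, and $\pi$ is the quotient map $W \to W/\mathfrak g \cong V$ (the morphism $\pi$ is affine and $\mathcal O_V = (\pi_*\mathcal O_W)^{\mathfrak g}$). A closed point $P \in V$ is called unramified in $W$ if the scheme-theoretic fibre $\pi^{-1}(P)$ contains no repeated points, i.e. is reduced. Then there is an abelian isogeny $h : G' \to G$ with group $\mathfrak g$, that is, a surjective homomorphism with finite kernel between connected commutative algebraic groups over $k$ which is also an abelian covering whose Galois group $\mathfrak g$ is the group of all automorphisms of $G'$ over $G$, such that for every closed point $P \in V$ that is unramified in $W$ there are rational maps $f : V \dashrightarrow G$ and $g : W \dashrightarrow G'$ over $k$ for which $f$ is regular at $P$ and $$\begin{array}{ccc} W & \stackrel{g}{\dashrightarrow} & G' \\ {\scriptstyle \pi}\downarrow & & \downarrow{\scriptstyle h} \\ V & \stackrel{f}{\dashrightarrow}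 & G \end{array}$$ is a pullback diagram. More precisely, there is an open neighbourhood $U$ of $P$ such that $f$ is regular on $U$, $g$ is regular and $\mathfrak g$-equivariant on $\pi^{-1}(U)$, and the square formed by $\pi^{-1}(U) \to G'$, $\pi^{-1}(U) \to U$, $h$ and $U \to G$ is a pullback square of schemes. -/

import Mathlib

open CategoryTheory CategoryTheory.Limits AlgebraicGeometry MonoidalCategory
  CartesianMonoidalCategory MonObj

universe u

namespace AbelianCovering

/-- A variety over `k` (not necessarily irreducible): a reduced separated `k`-scheme of finite
type. -/
structure IsVariety {k : Type u} [Field k] (X : Over (Spec (.of k))) : Prop where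
  isReduced : IsReduced X.left
  isSeparated : IsSeparated X.hom
  locallyOfFiniteType : LocallyOfFiniteType X.hom
  quasiCompact : QuasiCompact X.hom

/-- An automorphism of `W` over `V` preserves the preimages of the open subsets of `V`. -/
theorem preimage_le {V W : Scheme.{u}} (π : W ⟶ V) (σ : Aut (Over.mk π)) (U : V.Opens) :
    π ⁻¹ᵁ U ≤ σ.hom.left ⁻¹ᵁ (π ⁻¹ᵁ U) := by
  rw [← Scheme.Hom.comp_preimage]
  exact (congrArg (fun f : W ⟶ V => f ⁻¹ᵁ U) (Over.w σ.hom)).ge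

/-- `π : W ⟶ V` is a Galois covering with group `Γ`: the finite group `Γ` acts faithfully on `W`
by automorphisms over `V`, and `π` is the quotient `W ⟶ W / Γ`, that is, `V` has a cover by affine
open subsets with affine preimages in `W` (`π` is affine), and the functions on an open subset `U`
of `V` are the `Γ`-invariant functions on `π⁻¹(U)`.

When `W` is irreducible, faithfulness forces `Γ` to be the group of all automorphisms of `W`
over `V`. Requiring only faithfulness also admits the trivial covering
`V × Γ ⟶ V`, which has more automorphisms. -/
structure IsGaloisCovering {V W : Scheme.{u}} (π : W ⟶ V) {Γ : Type u} [Group Γ]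
    (ρ : Γ →* Aut (Over.mk π)) : Prop where
  finite : Finite Γ
  isAffineHom : IsAffineHom π
  injective_app (U : V.Opens) : Function.Injective (π.app U)
  range_app (U : V.Opens) : Set.range (π.app U) =
    {s | ∀ σ : Γ, (ρ σ).hom.left.appLE (π ⁻¹ᵁ U) (π ⁻¹ᵁ U) (preimage_le π (ρ σ) U) s = s}
  faithful : Function.Injective ρ

/-- The point `P` of `V` is unramified in `W`: the scheme-theoretic fibre `π⁻¹(P)` contains no
repeated point, that is, it is reduced. -/
def IsUnramifiedAt {V W : Scheme.{u}} (π : W ⟶ V) (P : V) : Prop :=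
  IsReduced (π.fiber P)

/-- A connected commutative algebraic group over `k`. -/
structure IsConnectedCommAlgebraicGroup {k : Type u} [Field k] (G : Over (Spec (.of k)))
    [GrpObj G] : Prop where
  isVariety : IsVariety G
  connected : ConnectedSpace G.left
  comm : IsCommMonObj G

/-- `h : G' ⟶ G` is an abelian isogeny with covering group `Γ`: a surjective homomorphism with
finite kernel between connected commutative algebraic groups, which is also a Galois covering with
abelian group `Γ`, where `Γ` is the group of all automorphisms of `G'` over `G`. -/
structure IsAbelianIsogeny {k : Type u} [Field k] {G' G : Over (Spec (.of k))}
    [GrpObj G'] [GrpObj G] (h : G' ⟶ G) {Γ : Type u} [CommGroup Γ]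
    (ρ : Γ →* Aut (Over.mk h.left)) : Prop where
  source : IsConnectedCommAlgebraicGroup G'
  target : IsConnectedCommAlgebraicGroup G
  isMonHom : IsMonHom h
  surjective : Surjective h.left
  finite_kernel : IsFinite (pullback.snd h.left η[G].left)
  isGaloisCovering : IsGaloisCovering h.left ρ
  surjective_aut : Function.Surjective ρ

/-- The square formed by the rational maps `g : W ⤏ G'`, `f : V ⤏ G` and the morphisms
`π : W ⟶ V`, `h : G' ⟶ G` is a pullback diagram over the open subset `U` of `V`, compatibly with
the actions of `Γ` on `W` over `V` and on `G'` over `G`: the map `f` is defined on `U` (by `fU`),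
`g` is defined on `π⁻¹(U)` (by `gU`) and `Γ`-equivariant there, and the square
```
  π⁻¹(U) --gU--> G'
    |            |
    U ----fU---> G
```
is a pullback square. -/
def IsPullbackOver {V W G' G : Scheme.{u}} (π : W ⟶ V) (h : G' ⟶ G) {Γ : Type u} [Group Γ]
    (ρ : Γ →* Aut (Over.mk π)) (ρ' : Γ →* Aut (Over.mk h))
    (g : W ⤏ G') (f : V ⤏ G) (U : V.Opens) : Prop :=
  ∃ (hU : Dense (U : Set V)) (hU' : Dense ((π ⁻¹ᵁ U : W.Opens) : Set W))
    (fU : U.toScheme ⟶ G) (gU : (π ⁻¹ᵁ U).toScheme ⟶ G'),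
    (Scheme.PartialMap.mk U hU fU).toRationalMap = f ∧
    (Scheme.PartialMap.mk (π ⁻¹ᵁ U) hU' gU).toRationalMap = g ∧
    (∀ σ : Γ, (ρ σ).hom.left.resLE (π ⁻¹ᵁ U) (π ⁻¹ᵁ U) (preimage_le π (ρ σ) U) ≫ gU =
      gU ≫ (ρ' σ).hom.left) ∧
    IsPullback gU (π ∣_ U) h fU

end AbelianCovering

/-! The proof is a geometric form of the normal basis theorem. `G'` is the group of units of the
group algebra of `Γ`: the open subset of the affine space with coordinates `x_σ` where the group
determinant does not vanish. It contains `Γ` as the group elements, and `G = G' / Γ`. Neither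
depends on `P`.

Let `Γ` act on `A` with invariants `B`. To `w` in `A` corresponds `θ(w) = ∑ (σ⁻¹ w) σ` in `A[Γ]`,
and applying `g` to the coefficients of `θ(w)` multiplies it by `g`. If `θ(w)` is a unit, it is
therefore a `Γ`-equivariant map `Spec A → G'`, which descends to `Spec B → G`. Moreover `θ(a)
θ(w)⁻¹` has invariant coefficients for every `a`, so the conjugates of `w` form a `B`-basis of `A`
(`orbitBasis`). The universal unit is itself `θ` of the coordinate `x_1`, so the classifying map
carries a basis to a basis, and the square is a pullback (`exists_isPushout_unitsRing`).

It remains to find, near `P`, a `w` whose `θ(w)` is a unit, that is, whose determinant `orbitDet w`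
is one. Let `p` be the ideal of `P` and `Q` a prime above it. If the inertia group of `Q` is
trivial, the decomposition group is the Galois group of the residue extension; a normal basis
generator there, extended by zero to the other conjugates of `Q`, lifts to a `w` with `orbitDet w`
outside `Q` (`exists_orbitDet_notMem`). Inverting the norm of the determinant then gives the
neighbourhood.

Unramifiedness makes the inertia trivial. As `Γ` is abelian and `pA` is radical, an inertia element
acts trivially on `A / pA`. Elements of `A` are simple roots modulo `pA`, because the residue field
is perfect, so a Newton argument gives triviality modulo every `pⁿA`. By Krull's intersection
theorem, for which `A` must be torsion free over `B`, the element acts trivially on `A`, and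
faithfulness finishes. -/

namespace AbelianCovering

/-! ### The group determinant. -/

section GroupAlgebra

variable {Γ : Type*} [CommGroup Γ] [Fintype Γ] [DecidableEq Γ]

/-- The element of the group algebra with given coefficients. -/
noncomputable def groupElement {Γ : Type*} [Finite Γ] {T : Type*} [Semiring T] (x : Γ → T) :
    MonoidAlgebra T Γ :=
  .ofCoeff (Finsupp.equivFunOnFinite.symm x)

@[simp]
theorem coeff_groupElement {Γ : Type*} [Finite Γ] {T : Type*} [Semiring T] (x : Γ → T) (σ : Γ) :
    (groupElement x).coeff σ = x σ := rfl

theorem coeff_mul_eq_sum {Γ : Type*} [CommGroup Γ] [Fintype Γ] {T : Type*} [Semiring T]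
    (x y : MonoidAlgebra T Γ) (σ : Γ) :
    (x * y).coeff σ = ∑ τ, x.coeff (σ * τ⁻¹) * y.coeff τ := by
  rw [MonoidAlgebra.coeff_mul_apply_right, Finsupp.sum_fintype _ _ (by simp)]

/-- The matrix of the multiplication by an element of the group algebra. -/
def groupMatrix {Γ : Type*} [CommGroup Γ] {T : Type*} (x : Γ → T) : Matrix Γ Γ T :=
  .of fun σ τ => x (σ * τ⁻¹)

theorem groupMatrix_mul {T : Type*} [CommRing T] (x y : MonoidAlgebra T Γ) :
    groupMatrix (x * y).coeff = groupMatrix x.coeff * groupMatrix y.coeff := by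
  ext σ τ
  simp only [groupMatrix, Matrix.of_apply, Matrix.mul_apply, coeff_mul_eq_sum]
  refine Fintype.sum_equiv (Equiv.mulRight τ) _ _ fun ρ => ?_
  simp only [Equiv.coe_mulRight, mul_inv_rev, mul_inv_cancel_right, ← _root_.mul_assoc]

/-- An element is a unit exactly when multiplication by it is bijective; its inverse is the inverse
matrix applied to the coordinate vector of `1`. -/
theorem isUnit_iff_isUnit_det_groupMatrix {T : Type*} [CommRing T] (x : MonoidAlgebra T Γ) :
    IsUnit x ↔ IsUnit (groupMatrix x.coeff).det := by
  constructor
  · rintro ⟨u, rfl⟩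
    have h := groupMatrix_mul u.1 u.2
    rw [u.val_inv] at h
    refine IsUnit.of_mul_eq_one (groupMatrix u.inv.coeff).det ?_
    rw [← Matrix.det_mul, ← h]
    convert Matrix.det_one (n := Γ) (R := T)
    ext σ τ
    simp [groupMatrix, Matrix.one_apply, MonoidAlgebra.one_def, Finsupp.single_apply,
      mul_inv_eq_one, eq_comm]
  · intro h
    refine IsUnit.of_mul_eq_one
      (groupElement ((groupMatrix x.coeff)⁻¹.mulVec (Pi.single 1 1))) ?_
    ext σ
    rw [coeff_mul_eq_sum]
    have := congrFun (Matrix.mulVec_mulVec (Pi.single 1 1) (groupMatrix x.coeff)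
      (groupMatrix x.coeff)⁻¹) σ
    rw [Matrix.mul_nonsing_inv _ h, Matrix.one_mulVec] at this
    simp only [coeff_groupElement]
    refine Eq.trans this ?_
    simp [MonoidAlgebra.one_def, Finsupp.single_apply, Pi.single_apply, eq_comm]

theorem map_det_groupMatrix {T T' : Type*} [CommRing T] [CommRing T'] (f : T →+* T') (x : Γ → T) :
    f (groupMatrix x).det = (groupMatrix (f ∘ x)).det := by
  rw [RingHom.map_det]
  rfl

end GroupAlgebra

/-! ### The ring representing the functor of units `T ↦ T[Γ]ˣ`. -/

section GroupAlgebraUnits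

open MvPolynomial

variable (k : Type*) [Field k] (Γ : Type*) [CommGroup Γ] [Fintype Γ] [DecidableEq Γ]

/-- The determinant of the generic element of the group algebra. -/
noncomputable def genericDet : MvPolynomial Γ k := (groupMatrix X).det

/-- Specializing the generic element to `1` makes the determinant a unit. -/
theorem genericDet_ne_zero : genericDet k Γ ≠ 0 := by
  intro h
  have := map_det_groupMatrix (aeval (Pi.single 1 1 : Γ → k)).toRingHom (X : Γ → MvPolynomial Γ k)
  rw [show (groupMatrix X).det = genericDet k Γ from rfl, h, map_zero] at this
  have h1 : IsUnit (1 : MonoidAlgebra k Γ) := isUnit_one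
  rw [isUnit_iff_isUnit_det_groupMatrix] at h1
  have h2 : (1 : MonoidAlgebra k Γ).coeff =
      ((aeval (Pi.single 1 1 : Γ → k)).toRingHom ∘ (X : Γ → MvPolynomial Γ k)) := by
    ext σ
    simp [MonoidAlgebra.one_def, Finsupp.single_apply, Pi.single_apply, eq_comm]
  rw [h2, ← this] at h1
  exact not_isUnit_zero h1

/-- The coordinate ring of the group of units of the group algebra. -/
def UnitsRing : Type _ := Localization.Away (genericDet k Γ)

noncomputable instance : CommRing (UnitsRing k Γ) :=
  inferInstanceAs (CommRing (Localization.Away (genericDet k Γ)))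

noncomputable instance : Algebra (MvPolynomial Γ k) (UnitsRing k Γ) :=
  inferInstanceAs (Algebra (MvPolynomial Γ k) (Localization.Away (genericDet k Γ)))

noncomputable instance : Algebra k (UnitsRing k Γ) :=
  inferInstanceAs (Algebra k (Localization.Away (genericDet k Γ)))

instance : IsScalarTower k (MvPolynomial Γ k) (UnitsRing k Γ) :=
  inferInstanceAs (IsScalarTower k (MvPolynomial Γ k) (Localization.Away (genericDet k Γ)))

instance : IsLocalization.Away (genericDet k Γ) (UnitsRing k Γ) :=
  inferInstanceAs (IsLocalization.Away (genericDet k Γ) (Localization.Away (genericDet k Γ)))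

instance : IsDomain (UnitsRing k Γ) :=
  IsLocalization.isDomain_of_le_nonZeroDivisors (R := MvPolynomial Γ k)
    (M := .powers (genericDet k Γ)) (UnitsRing k Γ)
    (powers_le_nonZeroDivisors_of_noZeroDivisors (genericDet_ne_zero k Γ))

instance : Algebra.FiniteType k (UnitsRing k Γ) :=
  .trans (S := MvPolynomial Γ k) inferInstance
    (IsLocalization.finiteType_of_monoid_fg (.powers (genericDet k Γ)) _)

/-- The coordinates on the group of units of the group algebra. -/
noncomputable def coord (σ : Γ) : UnitsRing k Γ := algebraMap (MvPolynomial Γ k) _ (X σ)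

/-- The universal unit of the group algebra. -/
noncomputable def universalUnit : MonoidAlgebra (UnitsRing k Γ) Γ := groupElement (coord k Γ)

theorem isUnit_universalUnit : IsUnit (universalUnit k Γ) := by
  rw [isUnit_iff_isUnit_det_groupMatrix]
  change IsUnit (groupMatrix (algebraMap (MvPolynomial Γ k) (UnitsRing k Γ) ∘ X)).det
  rw [← map_det_groupMatrix]
  exact IsLocalization.Away.algebraMap_isUnit (genericDet k Γ)

variable {k Γ}

theorem unitsRing_algHom_ext {T : Type*} [CommRing T] [Algebra k T] {f g : UnitsRing k Γ →ₐ[k] T}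
    (h : MonoidAlgebra.mapAlgHom Γ f (universalUnit k Γ) =
      MonoidAlgebra.mapAlgHom Γ g (universalUnit k Γ)) : f = g := by
  refine IsLocalization.algHom_ext (R := k) (.powers (genericDet k Γ)) ?_
  refine MvPolynomial.algHom_ext fun σ => ?_
  have := congrArg (fun z => z.coeff σ) h
  simp only [universalUnit, MonoidAlgebra.coeff_mapAlgHom] at this
  exact this

/-- The morphism from the coordinate ring of the group of units of the group algebra that sends the
universal unit to a given unit. -/
noncomputable def unitsLift {T : Type*} [CommRing T] [Algebra k T] (x : MonoidAlgebra T Γ)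
    (hx : IsUnit x) : UnitsRing k Γ →ₐ[k] T :=
  IsLocalization.liftAlgHom (M := .powers (genericDet k Γ)) (f := aeval (R := k) x.coeff) (by
    rintro ⟨_, n, rfl⟩
    rw [map_pow]
    refine IsUnit.pow n ?_
    rw [isUnit_iff_isUnit_det_groupMatrix] at hx
    convert hx
    refine (map_det_groupMatrix (aeval x.coeff).toRingHom (X : Γ → MvPolynomial Γ k)).trans ?_
    congr 2
    ext
    simp)

theorem unitsLift_coord {T : Type*} [CommRing T] [Algebra k T] (x : MonoidAlgebra T Γ)
    (hx : IsUnit x) (σ : Γ) : unitsLift (k := k) x hx (coord k Γ σ) = x.coeff σ := by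
  simp [unitsLift, coord]

@[simp]
theorem map_unitsLift_universalUnit {T : Type*} [CommRing T] [Algebra k T] (x : MonoidAlgebra T Γ)
    (hx : IsUnit x) : MonoidAlgebra.mapAlgHom Γ (unitsLift (k := k) x hx) (universalUnit k Γ) = x := by
  ext σ
  simp [universalUnit, unitsLift_coord]

end GroupAlgebraUnits
end AbelianCovering

namespace AbelianCovering

/-! ### The Hopf algebra of the group of units. -/

section HopfAlgebra

open TensorProduct Algebra.TensorProduct

variable (k : Type*) [Field k] (Γ : Type*) [CommGroup Γ] [Fintype Γ] [DecidableEq Γ]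

variable {k Γ} in
/-- The unit of the group algebra that corresponds to a point of the group of units. -/
noncomputable def unitOf {T : Type*} [CommRing T] [Algebra k T] (f : UnitsRing k Γ →ₐ[k] T) :
    MonoidAlgebra T Γ :=
  MonoidAlgebra.mapAlgHom Γ f (universalUnit k Γ)

variable {k Γ} in
theorem isUnit_unitOf {T : Type*} [CommRing T] [Algebra k T] (f : UnitsRing k Γ →ₐ[k] T) :
    IsUnit (unitOf f) :=
  (isUnit_universalUnit k Γ).map _

variable {k Γ} in
theorem unitOf_comp {T T' : Type*} [CommRing T] [Algebra k T] [CommRing T'] [Algebra k T']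
    (g : T →ₐ[k] T') (f : UnitsRing k Γ →ₐ[k] T) :
    unitOf (g.comp f) = MonoidAlgebra.mapAlgHom Γ g (unitOf f) := by
  simp [unitOf, MonoidAlgebra.mapRangeAlgHom_comp]

variable {k Γ} in
@[simp]
theorem unitOf_unitsLift {T : Type*} [CommRing T] [Algebra k T] (x : MonoidAlgebra T Γ)
    (hx : IsUnit x) : unitOf (unitsLift (k := k) x hx) = x :=
  map_unitsLift_universalUnit x hx

variable {k Γ} in
-- Yoneda: this reduces each Hopf algebra axiom to an identity between units of `T[Γ]`, where it is
-- associativity, a unit law, an inverse law or commutativity.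
theorem unitOf_injective {T : Type*} [CommRing T] [Algebra k T] :
    Function.Injective (unitOf (k := k) (Γ := Γ) (T := T)) :=
  fun _ _ h => unitsRing_algHom_ext h

/-- The comultiplication of the group of units of the group algebra. -/
noncomputable def unitsComul : UnitsRing k Γ →ₐ[k] UnitsRing k Γ ⊗[k] UnitsRing k Γ :=
  unitsLift (unitOf includeLeft * unitOf includeRight)
    ((isUnit_unitOf _).mul (isUnit_unitOf _))

/-- The counit of the group of units of the group algebra. -/
noncomputable def unitsCounit : UnitsRing k Γ →ₐ[k] k := unitsLift 1 isUnit_one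

/-- The antipode of the group of units of the group algebra. -/
noncomputable def unitsAntipode : UnitsRing k Γ →ₐ[k] UnitsRing k Γ :=
  unitsLift (↑(isUnit_universalUnit k Γ).unit⁻¹) (Units.isUnit _)

variable {k Γ} in
theorem unitOf_comp_unitsComul {T : Type*} [CommRing T] [Algebra k T]
    (f : UnitsRing k Γ ⊗[k] UnitsRing k Γ →ₐ[k] T) :
    unitOf (f.comp (unitsComul k Γ)) =
      unitOf (f.comp includeLeft) * unitOf (f.comp includeRight) := by
  simp [unitOf_comp, unitsComul]

variable {k Γ} in
theorem unitOf_comp_unitsCounit {T : Type*} [CommRing T] [Algebra k T] (f : k →ₐ[k] T) :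
    unitOf (f.comp (unitsCounit k Γ)) = 1 := by
  simp [unitOf_comp, unitsCounit]

theorem unitOf_id : unitOf (AlgHom.id k (UnitsRing k Γ)) = universalUnit k Γ := by
  simp [unitOf]

theorem unitOf_unitsAntipode_mul : unitOf (unitsAntipode k Γ) * universalUnit k Γ = 1 := by
  simp [unitsAntipode]

theorem unitsComul_coassoc :
    (Algebra.TensorProduct.assoc k k k (UnitsRing k Γ) (UnitsRing k Γ)
      (UnitsRing k Γ)).toAlgHom.comp ((Algebra.TensorProduct.map (unitsComul k Γ)
        (AlgHom.id k (UnitsRing k Γ))).comp (unitsComul k Γ)) =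
    (Algebra.TensorProduct.map (AlgHom.id k (UnitsRing k Γ)) (unitsComul k Γ)).comp
      (unitsComul k Γ) := by
  apply unitOf_injective (T := (UnitsRing k Γ) ⊗[k] ((UnitsRing k Γ) ⊗[k] (UnitsRing k Γ)))
  rw [← AlgHom.comp_assoc, unitOf_comp_unitsComul, unitOf_comp_unitsComul]
  have h1 : (Algebra.TensorProduct.map (unitsComul k Γ) (.id k (UnitsRing k Γ))).comp includeLeft =
      includeLeft.comp (unitsComul k Γ) := by ext; simp
  have h2 : (Algebra.TensorProduct.map (unitsComul k Γ) (.id k (UnitsRing k Γ))).comp includeRight =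
      includeRight := by ext; simp
  have h3 : (Algebra.TensorProduct.map (.id k (UnitsRing k Γ)) (unitsComul k Γ)).comp includeRight =
      includeRight.comp (unitsComul k Γ) := by ext; simp
  have h4 : (Algebra.TensorProduct.map (.id k (UnitsRing k Γ)) (unitsComul k Γ)).comp
      includeLeft = includeLeft := by ext; simp
  rw [AlgHom.comp_assoc, h1, AlgHom.comp_assoc, h2, h3, h4, ← AlgHom.comp_assoc,
    unitOf_comp_unitsComul, unitOf_comp_unitsComul, _root_.mul_assoc]
  rfl

theorem unitsCounit_rTensor :
    (Algebra.TensorProduct.map (unitsCounit k Γ) (.id k (UnitsRing k Γ))).comp (unitsComul k Γ) =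
      (Algebra.TensorProduct.lid k (UnitsRing k Γ)).symm := by
  apply unitOf_injective (T := k ⊗[k] UnitsRing k Γ)
  have h1 : (Algebra.TensorProduct.map (unitsCounit k Γ) (.id k (UnitsRing k Γ))).comp includeLeft =
      (Algebra.ofId k _).comp (unitsCounit k Γ) := by
    ext x
    simp [Algebra.ofId_apply]
  rw [unitOf_comp_unitsComul, h1, unitOf_comp_unitsCounit, _root_.one_mul]
  congr 1
  ext
  simp

theorem unitsCounit_lTensor :
    (Algebra.TensorProduct.map (.id k (UnitsRing k Γ)) (unitsCounit k Γ)).comp (unitsComul k Γ) =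
      (Algebra.TensorProduct.rid k k (UnitsRing k Γ)).symm := by
  apply unitOf_injective (T := UnitsRing k Γ ⊗[k] k)
  have h1 : (Algebra.TensorProduct.map (.id k (UnitsRing k Γ)) (unitsCounit k Γ)).comp includeRight =
      (Algebra.ofId k _).comp (unitsCounit k Γ) := by
    ext x
    simp [Algebra.ofId_apply, Algebra.algebraMap_eq_smul_one (A := UnitsRing k Γ), smul_tmul]
  rw [unitOf_comp_unitsComul, h1, unitOf_comp_unitsCounit, _root_.mul_one]
  congr 1
  ext
  simp

noncomputable instance : Bialgebra k (UnitsRing k Γ) :=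
  .ofAlgHom (unitsComul k Γ) (unitsCounit k Γ) (unitsComul_coassoc k Γ) (unitsCounit_rTensor k Γ)
    (unitsCounit_lTensor k Γ)

theorem unitsAntipode_rTensor :
    (Algebra.TensorProduct.lift (unitsAntipode k Γ) (.id k (UnitsRing k Γ))
      fun _ _ => Commute.all _ _).comp (unitsComul k Γ) =
      (Algebra.ofId k (UnitsRing k Γ)).comp (unitsCounit k Γ) := by
  apply unitOf_injective
  have h : (Algebra.TensorProduct.lift (unitsAntipode k Γ) (.id k (UnitsRing k Γ))
      fun _ _ => Commute.all _ _).comp includeRight = .id k (UnitsRing k Γ) := by ext; simp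
  rw [unitOf_comp_unitsComul, unitOf_comp_unitsCounit, Algebra.TensorProduct.lift_comp_includeLeft,
    h, unitOf_id, unitOf_unitsAntipode_mul]

theorem unitsAntipode_lTensor :
    (Algebra.TensorProduct.lift (.id k (UnitsRing k Γ)) (unitsAntipode k Γ)
      fun _ _ => Commute.all _ _).comp (unitsComul k Γ) =
      (Algebra.ofId k (UnitsRing k Γ)).comp (unitsCounit k Γ) := by
  apply unitOf_injective
  have h : (Algebra.TensorProduct.lift (.id k (UnitsRing k Γ)) (unitsAntipode k Γ)
      fun _ _ => Commute.all _ _).comp includeRight = unitsAntipode k Γ := by ext; simp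
  rw [unitOf_comp_unitsComul, unitOf_comp_unitsCounit, Algebra.TensorProduct.lift_comp_includeLeft,
    h, unitOf_id, _root_.mul_comm,
    unitOf_unitsAntipode_mul]

noncomputable instance : HopfAlgebra k (UnitsRing k Γ) :=
  .ofAlgHom (unitsAntipode k Γ) (unitsAntipode_rTensor k Γ) (unitsAntipode_lTensor k Γ)

theorem comm_comp_unitsComul :
    (Algebra.TensorProduct.comm k (UnitsRing k Γ) (UnitsRing k Γ)).toAlgHom.comp
      (unitsComul k Γ) = unitsComul k Γ := by
  apply unitOf_injective (T := UnitsRing k Γ ⊗[k] UnitsRing k Γ)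
  rw [unitOf_comp_unitsComul, unitsComul, unitOf_unitsLift, _root_.mul_comm]
  congr 2

instance : Coalgebra.IsCocomm k (UnitsRing k Γ) where
  comm_comp_comul := congrArg AlgHom.toLinearMap (comm_comp_unitsComul k Γ)

end HopfAlgebra
end AbelianCovering

namespace AbelianCovering

/-! ### Orbit elements and bases of conjugates. -/

section OrbitElement

variable {Γ : Type*} [CommGroup Γ] [Fintype Γ] {A : Type*} [CommRing A] [MulSemiringAction Γ A]

/-- The element of the group algebra whose coefficients are the conjugates of a given element. -/
noncomputable def orbitElement (Γ : Type*) [CommGroup Γ] [Fintype Γ] {A : Type*} [CommRing A]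
    [MulSemiringAction Γ A] (w : A) : MonoidAlgebra A Γ :=
  groupElement fun σ => σ⁻¹ • w

theorem map_smul_orbitElement (g : Γ) (w : A) :
    MonoidAlgebra.mapRingHom Γ (MulSemiringAction.toRingHom Γ A g) (orbitElement Γ w) =
      orbitElement Γ w * .single g 1 := by
  ext σ
  simp only [orbitElement, MonoidAlgebra.coeff_mapRingHom, coeff_groupElement,
    MonoidAlgebra.coeff_mul_single_apply, _root_.mul_one, MulSemiringAction.toRingHom_apply,
    smul_smul, mul_inv_rev, inv_inv]

/-- In the quotient of the orbit elements of `a` and `w`, the factor `g` produced by the action of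
`g` cancels, so its coefficients are invariant. The expansion of `a` is the coefficient at `1`. -/
theorem exists_invariant_coeff {w : A} (hw : IsUnit (orbitElement Γ w)) (a : A) :
    ∃ c : Γ → A, (∀ σ g : Γ, g • c σ = c σ) ∧ ∑ σ, c σ * σ • w = a := by
  obtain ⟨c, hc⟩ : ∃ c, c * orbitElement Γ w = orbitElement Γ a :=
    ⟨orbitElement Γ a * ↑hw.unit⁻¹, by simp [_root_.mul_assoc]⟩
  refine ⟨c.coeff, fun σ g => ?_, ?_⟩
  · have h1 : IsUnit (MonoidAlgebra.single g (1 : A)) :=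
      IsUnit.of_mul_eq_one (MonoidAlgebra.single g⁻¹ 1) (by simp [MonoidAlgebra.one_def])
    have h : MonoidAlgebra.mapRingHom Γ (MulSemiringAction.toRingHom Γ A g) c = c := by
      refine (hw.mul h1).mul_right_cancel ?_
      have := congrArg (MonoidAlgebra.mapRingHom Γ (MulSemiringAction.toRingHom Γ A g)) hc
      rw [map_mul, map_smul_orbitElement, map_smul_orbitElement, ← hc] at this
      rw [this, _root_.mul_assoc]
    simpa using congrArg (fun z => z.coeff σ) h
  · have := congrArg (fun z => z.coeff 1) hc
    simp only [coeff_mul_eq_sum, _root_.one_mul, orbitElement, coeff_groupElement, inv_one,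
      one_smul] at this
    rw [← this]
    exact Fintype.sum_equiv (Equiv.inv Γ) _ _ (by simp)

/-- The conjugates of the relation say together that the element with coefficients `c` annihilates
the orbit element of `w`. -/
theorem invariant_coeff_eq_zero {w : A} (hw : IsUnit (orbitElement Γ w)) {c : Γ → A}
    (hc : ∀ σ g : Γ, g • c σ = c σ) (h : ∑ σ, c σ * σ • w = 0) : c = 0 := by
  have h0 : groupElement c * orbitElement Γ w = 0 := by
    ext ρ
    have h1 := congrArg (ρ⁻¹ • ·) h
    simp only [Finset.smul_sum, smul_mul', hc, smul_zero, smul_smul] at h1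
    simp only [coeff_mul_eq_sum, orbitElement, coeff_groupElement]
    rw [MonoidAlgebra.coeff_zero, Finsupp.zero_apply, ← h1]
    refine Fintype.sum_equiv ((Equiv.inv Γ).trans (Equiv.mulLeft ρ)) _ _ fun τ => ?_
    simp
  have := hw.mul_left_eq_zero.1 h0
  ext σ
  simpa using congrArg (fun z => z.coeff σ) this

variable {B : Type*} [CommRing B] [Algebra B A] [SMulCommClass Γ B A] [Algebra.IsInvariant B A Γ]

/-- The conjugates of an element whose orbit element is invertible form a basis of the ring over the
ring of invariants. -/
noncomputable def orbitBasis (hB : Function.Injective (algebraMap B A)) {w : A}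
    (hw : IsUnit (orbitElement Γ w)) : Module.Basis Γ B A :=
  .mk (v := fun σ : Γ => σ • w)
    (by
      rw [Fintype.linearIndependent_iff]
      intro c hc σ
      have := invariant_coeff_eq_zero hw (c := fun σ => algebraMap B A (c σ))
        (fun σ g => smul_algebraMap g _) (by simpa [Algebra.smul_def] using hc)
      exact hB (by simpa using congrFun this σ))
    (by
      intro a _
      obtain ⟨c, hc, rfl⟩ := exists_invariant_coeff hw a
      refine Submodule.sum_mem _ fun σ _ => ?_
      obtain ⟨b, hb⟩ := Algebra.IsInvariant.isInvariant (A := B) (c σ) (hc σ)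
      rw [← hb, ← Algebra.smul_def]
      exact Submodule.smul_mem _ _ (Submodule.subset_span ⟨σ, rfl⟩))

@[simp]
theorem orbitBasis_apply (hB : Function.Injective (algebraMap B A)) {w : A}
    (hw : IsUnit (orbitElement Γ w)) (σ : Γ) : orbitBasis hB hw σ = σ • w := by
  simp [orbitBasis]

end OrbitElement

/-! ### Pushouts detected on bases. -/

section Pushout

open TensorProduct

theorem isPushout_of_basis {R S R' S' I : Type*} [CommRing R] [CommRing S] [CommRing R']
    [CommRing S'] [Algebra R S] [Algebra S S'] [Algebra R R'] [Algebra R' S'] [Algebra R S']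
    [IsScalarTower R R' S'] [IsScalarTower R S S'] (b : Module.Basis I R R')
    (b' : Module.Basis I S S') (h : ∀ i, algebraMap R' S' (b i) = b' i) :
    Algebra.IsPushout R S R' S' where
  out := by
    refine IsBaseChange.of_equiv ((Algebra.TensorProduct.basis S b).equiv b' (.refl I)) fun x => ?_
    have : ((((Algebra.TensorProduct.basis S b).equiv b' (.refl I)).toLinearMap.restrictScalars R) ∘ₗ
        TensorProduct.mk R S R' 1) = (IsScalarTower.toAlgHom R R' S').toLinearMap := by
      refine b.ext fun i => ?_
      have := (Algebra.TensorProduct.basis S b).equiv_apply i b' (.refl I)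
      rw [Algebra.TensorProduct.basis_apply] at this
      simpa [h] using this
    exact LinearMap.congr_fun this x

end Pushout

/-! ### Invariants in a tensor square. -/

section Invariants

open TensorProduct

/-- An element of the tensor square of a vector space that is fixed by the operators of a family
on each factor comes from the tensor square of the subspace of fixed vectors. -/
theorem mem_range_map_subtype_of_fixed {k V I : Type*} [Field k] [AddCommGroup V] [Module k V]
    (S : Submodule k V) (f : I → V →ₗ[k] V) (hS : ∀ v, v ∈ S ↔ ∀ i, f i v = v) (z : V ⊗[k] V)
    (h₁ : ∀ i, TensorProduct.map (f i) .id z = z) (h₂ : ∀ i, TensorProduct.map .id (f i) z = z) :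
    z ∈ LinearMap.range (TensorProduct.map S.subtype S.subtype) := by
  classical
  obtain ⟨p, hp⟩ := S.subtype.exists_leftInverse_of_injective S.ker_subtype
  have hpS (v : V) (hv : v ∈ S) : (p v : V) = v :=
    congrArg Subtype.val (LinearMap.congr_fun hp ⟨v, hv⟩)
  let b := Module.Basis.ofVectorSpace k V
  -- Written in a basis of the right factor, `z` has coefficients fixed by every `f i`, hence in
  -- `S`, where the projection `p` is the identity.
  have key₁ : TensorProduct.map (S.subtype ∘ₗ p) .id z = z := by
    refine (TensorProduct.equivFinsuppOfBasisRight b).injective (Finsupp.ext fun i => ?_)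
    have hc (g : V →ₗ[k] V) (y : V ⊗[k] V) : TensorProduct.equivFinsuppOfBasisRight b
        (TensorProduct.map g .id y) i = g (TensorProduct.equivFinsuppOfBasisRight b y i) := by
      induction y with
      | zero => simp
      | add x y hx hy => simp [hx, hy]
      | tmul x y => simp
    rw [hc]
    refine hpS _ ((hS _).2 fun j => ?_)
    rw [← hc, h₁]
  have key₂ : TensorProduct.map .id (S.subtype ∘ₗ p) z = z := by
    refine (TensorProduct.equivFinsuppOfBasisLeft b).injective (Finsupp.ext fun i => ?_)
    have hc (g : V →ₗ[k] V) (y : V ⊗[k] V) : TensorProduct.equivFinsuppOfBasisLeft b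
        (TensorProduct.map .id g y) i = g (TensorProduct.equivFinsuppOfBasisLeft b y i) := by
      induction y with
      | zero => simp
      | add x y hx hy => simp [hx, hy]
      | tmul x y => simp
    rw [hc]
    refine hpS _ ((hS _).2 fun j => ?_)
    rw [← hc, h₂]
  refine ⟨TensorProduct.map p p z, ?_⟩
  have h : TensorProduct.map S.subtype S.subtype (TensorProduct.map p p z) =
      TensorProduct.map (S.subtype ∘ₗ p) .id (TensorProduct.map .id (S.subtype ∘ₗ p) z) := by
    simp only [← LinearMap.comp_apply, ← TensorProduct.map_comp, LinearMap.id_comp,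
      LinearMap.comp_id]
  rw [h, key₂, key₁]

end Invariants

end AbelianCovering

namespace AbelianCovering

/-! ### Translation by `Γ` on the group of units, and its invariants. -/

section UnitsAction

open TensorProduct

theorem isUnit_single {Γ : Type*} [CommGroup Γ] {T : Type*} [CommRing T] (σ : Γ) :
    IsUnit (MonoidAlgebra.single σ (1 : T)) :=
  IsUnit.of_mul_eq_one (MonoidAlgebra.single σ⁻¹ 1) (by simp [MonoidAlgebra.one_def])

variable (k : Type*) [Field k] (Γ : Type*) [CommGroup Γ] [Fintype Γ] [DecidableEq Γ]

/-- The translation of the group of units of the group algebra by an element of the group. -/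
noncomputable def translation (σ : Γ) : UnitsRing k Γ →ₐ[k] UnitsRing k Γ :=
  unitsLift (universalUnit k Γ * .single σ 1) ((isUnit_universalUnit k Γ).mul (isUnit_single σ))

theorem unitOf_comp_translation {T : Type*} [CommRing T] [Algebra k T]
    (f : UnitsRing k Γ →ₐ[k] T) (σ : Γ) :
    unitOf (f.comp (translation k Γ σ)) = unitOf f * .single σ 1 := by
  rw [unitOf_comp, translation, unitOf_unitsLift, map_mul, MonoidAlgebra.mapAlgHom_single, map_one]
  rfl

noncomputable instance : MulSemiringAction Γ (UnitsRing k Γ) where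
  smul σ x := translation k Γ σ x
  one_smul x := by
    have : translation k Γ 1 = AlgHom.id k _ := by
      apply unitOf_injective
      rw [← AlgHom.id_comp (translation k Γ 1), unitOf_comp_translation, ← MonoidAlgebra.one_def,
        _root_.mul_one]
    exact DFunLike.congr_fun this x
  mul_smul σ τ x := by
    have : translation k Γ (σ * τ) = (translation k Γ σ).comp (translation k Γ τ) := by
      apply unitOf_injective
      rw [unitOf_comp_translation, ← AlgHom.id_comp (translation k Γ (σ * τ)),
        ← AlgHom.id_comp (translation k Γ σ), unitOf_comp_translation, unitOf_comp_translation,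
        _root_.mul_assoc, MonoidAlgebra.single_mul_single, _root_.mul_one]
    exact DFunLike.congr_fun this x
  smul_zero σ := map_zero (translation k Γ σ)
  smul_add σ := map_add (translation k Γ σ)
  smul_one σ := map_one (translation k Γ σ)
  smul_mul σ := map_mul (translation k Γ σ)

variable {k Γ}

theorem smul_eq_translation (σ : Γ) (x : UnitsRing k Γ) : σ • x = translation k Γ σ x := rfl

instance : SMulCommClass Γ k (UnitsRing k Γ) where
  smul_comm σ a x := map_smul (translation k Γ σ) a x

theorem smul_coord (σ τ : Γ) : σ • coord k Γ τ = coord k Γ (σ⁻¹ * τ) := by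
  rw [smul_eq_translation, translation, unitsLift_coord, MonoidAlgebra.coeff_mul_single_apply,
    _root_.mul_one, _root_.mul_comm]
  rfl

theorem coord_injective : Function.Injective (coord k Γ) :=
  (IsLocalization.injective (UnitsRing k Γ)
    (powers_le_nonZeroDivisors_of_noZeroDivisors (genericDet_ne_zero k Γ))).comp
    MvPolynomial.X_injective

/-- This brings the universal case under the results on orbit elements, so that `UnitsRing k Γ` is
free over its invariants. -/
theorem orbitElement_coord_one : orbitElement Γ (coord k Γ 1) = universalUnit k Γ := by
  ext σ
  simp [orbitElement, universalUnit, smul_coord]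

instance : FaithfulSMul Γ (UnitsRing k Γ) where
  eq_of_smul_eq_smul {σ τ} h := by
    have := h (coord k Γ 1)
    rw [smul_coord, smul_coord] at this
    simpa using coord_injective this

variable (k Γ)

/-- The coordinate ring of the quotient by the group of the group of units of the group algebra. -/
noncomputable abbrev QuotientRing : Subalgebra k (UnitsRing k Γ) := FixedPoints.subalgebra k (UnitsRing k Γ) Γ

instance : Algebra.IsInvariant (QuotientRing k Γ) (UnitsRing k Γ) Γ where
  isInvariant x hx := ⟨⟨x, hx⟩, rfl⟩

instance : IsGaloisGroup Γ (QuotientRing k Γ) (UnitsRing k Γ) where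
  faithful := inferInstance
  commutes := inferInstance
  isInvariant := inferInstance

/-- The translates of a coordinate form a basis of the coordinate ring of the group of units of the
group algebra over the ring of invariants. -/
noncomputable def unitsBasis : Module.Basis Γ (QuotientRing k Γ) (UnitsRing k Γ) :=
  orbitBasis Subtype.val_injective (w := coord k Γ 1)
    (by rw [orbitElement_coord_one]; exact isUnit_universalUnit k Γ)

instance : Module.Finite (QuotientRing k Γ) (UnitsRing k Γ) := .of_basis (unitsBasis k Γ)

/-- Artin–Tate: `UnitsRing k Γ` is of finite type over `k` and finite over the invariants. -/
instance : Algebra.FiniteType k (QuotientRing k Γ) :=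
  ⟨fg_of_fg_of_fg k (QuotientRing k Γ) (UnitsRing k Γ) Algebra.FiniteType.out Module.Finite.fg_top
    Subtype.val_injective⟩

end UnitsAction

/-! ### Hopf structures on subalgebras. -/

section QuotientHopf

open TensorProduct

variable {k R : Type*} [Field k] [CommRing R]

/-- Modules over a field are flat. Identities in tensor powers of `S` can therefore be checked in
those of `R`. -/
theorem map_val_injective [Algebra k R] (S : Subalgebra k R) :
    Function.Injective (Algebra.TensorProduct.map S.val S.val) :=
  TensorProduct.map_injective_of_flat_flat S.val.toLinearMap S.val.toLinearMap
    Subtype.val_injective Subtype.val_injective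

/-- The comultiplication of a subalgebra that is stable under the comultiplication. -/
noncomputable def subComul [Bialgebra k R] (S : Subalgebra k R)
    (hS : ∀ s ∈ S, Bialgebra.comulAlgHom k R s ∈ (Algebra.TensorProduct.map S.val S.val).range) :
    S →ₐ[k] S ⊗[k] S :=
  (AlgEquiv.ofInjective _ (map_val_injective S)).symm.toAlgHom.comp
    (((Bialgebra.comulAlgHom k R).comp S.val).codRestrict _ fun s => hS s s.2)

theorem map_comp_subComul [Bialgebra k R] (S : Subalgebra k R)
    (hS : ∀ s ∈ S, Bialgebra.comulAlgHom k R s ∈ (Algebra.TensorProduct.map S.val S.val).range) :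
    (Algebra.TensorProduct.map S.val S.val).comp (subComul S hS) =
      (Bialgebra.comulAlgHom k R).comp S.val := by
  ext s
  exact congrArg Subtype.val ((AlgEquiv.ofInjective _ (map_val_injective S)).apply_symm_apply
    ⟨Bialgebra.comulAlgHom k R s, hS s s.2⟩)

theorem subComul_coassoc [Bialgebra k R] (S : Subalgebra k R)
    (hS : ∀ s ∈ S, Bialgebra.comulAlgHom k R s ∈ (Algebra.TensorProduct.map S.val S.val).range) :
    (Algebra.TensorProduct.assoc k k k S S S).toAlgHom.comp
        ((Algebra.TensorProduct.map (subComul S hS) (.id k S)).comp (subComul S hS)) =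
      (Algebra.TensorProduct.map (.id k S) (subComul S hS)).comp (subComul S hS) := by
  have hR : (Algebra.TensorProduct.assoc k k k R R R).toAlgHom.comp
      ((Algebra.TensorProduct.map (Bialgebra.comulAlgHom k R) (.id k R)).comp
        (Bialgebra.comulAlgHom k R)) =
      (Algebra.TensorProduct.map (.id k R) (Bialgebra.comulAlgHom k R)).comp
        (Bialgebra.comulAlgHom k R) :=
    AlgHom.toLinearMap_injective Coalgebra.coassoc
  have hv := map_comp_subComul S hS
  have hinj : Function.Injective (Algebra.TensorProduct.map S.val
      (Algebra.TensorProduct.map S.val S.val)) :=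
    TensorProduct.map_injective_of_flat_flat S.val.toLinearMap
      (Algebra.TensorProduct.map S.val S.val).toLinearMap Subtype.val_injective
      (map_val_injective S)
  refine (AlgHom.cancel_left hinj).1 ?_
  have h1 : (Algebra.TensorProduct.map S.val (Algebra.TensorProduct.map S.val S.val)).comp
      (Algebra.TensorProduct.assoc k k k S S S).toAlgHom =
      (Algebra.TensorProduct.assoc k k k R R R).toAlgHom.comp
        (Algebra.TensorProduct.map (Algebra.TensorProduct.map S.val S.val) S.val) := by
    ext <;> simp [Algebra.TensorProduct.one_def]
  have h2 : (Algebra.TensorProduct.map (Algebra.TensorProduct.map S.val S.val) S.val).comp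
      (Algebra.TensorProduct.map (subComul S hS) (.id k S)) =
      (Algebra.TensorProduct.map (Bialgebra.comulAlgHom k R) (.id k R)).comp
        (Algebra.TensorProduct.map S.val S.val) := by
    rw [← Algebra.TensorProduct.map_comp, ← Algebra.TensorProduct.map_comp, hv]
    rfl
  have h3 : (Algebra.TensorProduct.map S.val (Algebra.TensorProduct.map S.val S.val)).comp
      (Algebra.TensorProduct.map (.id k S) (subComul S hS)) =
      (Algebra.TensorProduct.map (.id k R) (Bialgebra.comulAlgHom k R)).comp
        (Algebra.TensorProduct.map S.val S.val) := by
    rw [← Algebra.TensorProduct.map_comp, ← Algebra.TensorProduct.map_comp, hv]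
    rfl
  refine AlgHom.ext fun s => ?_
  have ev := DFunLike.congr_fun hv s
  have e2 := (DFunLike.congr_fun h2 (subComul S hS s)).trans
    (congrArg (Algebra.TensorProduct.map (Bialgebra.comulAlgHom k R) (.id k R)) ev)
  have e3 := (DFunLike.congr_fun h3 (subComul S hS s)).trans
    (congrArg (Algebra.TensorProduct.map (.id k R) (Bialgebra.comulAlgHom k R)) ev)
  exact (DFunLike.congr_fun h1 _).trans ((congrArg (Algebra.TensorProduct.assoc k k k R R R)
    e2).trans ((DFunLike.congr_fun hR (s : R)).trans e3.symm))

theorem subCounit_rTensor [Bialgebra k R] (S : Subalgebra k R)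
    (hS : ∀ s ∈ S, Bialgebra.comulAlgHom k R s ∈ (Algebra.TensorProduct.map S.val S.val).range) :
    (Algebra.TensorProduct.map ((Bialgebra.counitAlgHom k R).comp S.val) (.id k S)).comp
      (subComul S hS) = (Algebra.TensorProduct.lid k S).symm := by
  have hinj : Function.Injective (Algebra.TensorProduct.map (.id k k) S.val) :=
    TensorProduct.map_injective_of_flat_flat (AlgHom.id k k).toLinearMap S.val.toLinearMap
      Function.injective_id Subtype.val_injective
  refine (AlgHom.cancel_left hinj).1 ?_
  have h2 : (Algebra.TensorProduct.map (.id k k) S.val).comp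
      (Algebra.TensorProduct.map ((Bialgebra.counitAlgHom k R).comp S.val) (.id k S)) =
      (Algebra.TensorProduct.map (Bialgebra.counitAlgHom k R) (.id k R)).comp
        (Algebra.TensorProduct.map S.val S.val) := by
    rw [← Algebra.TensorProduct.map_comp, ← Algebra.TensorProduct.map_comp]
    rfl
  rw [← AlgHom.comp_assoc, h2, AlgHom.comp_assoc, map_comp_subComul]
  ext s
  exact Coalgebra.rTensor_counit_comul (R := k) (s : R)

theorem subCounit_lTensor [Bialgebra k R] (S : Subalgebra k R)
    (hS : ∀ s ∈ S, Bialgebra.comulAlgHom k R s ∈ (Algebra.TensorProduct.map S.val S.val).range) :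
    (Algebra.TensorProduct.map (.id k S) ((Bialgebra.counitAlgHom k R).comp S.val)).comp
      (subComul S hS) = (Algebra.TensorProduct.rid k k S).symm := by
  have hinj : Function.Injective (Algebra.TensorProduct.map S.val (.id k k)) :=
    TensorProduct.map_injective_of_flat_flat S.val.toLinearMap (AlgHom.id k k).toLinearMap
      Subtype.val_injective Function.injective_id
  refine (AlgHom.cancel_left hinj).1 ?_
  have h2 : (Algebra.TensorProduct.map S.val (.id k k)).comp
      (Algebra.TensorProduct.map (.id k S) ((Bialgebra.counitAlgHom k R).comp S.val)) =
      (Algebra.TensorProduct.map (.id k R) (Bialgebra.counitAlgHom k R)).comp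
        (Algebra.TensorProduct.map S.val S.val) := by
    rw [← Algebra.TensorProduct.map_comp, ← Algebra.TensorProduct.map_comp]
    rfl
  rw [← AlgHom.comp_assoc, h2, AlgHom.comp_assoc, map_comp_subComul]
  ext s
  exact Coalgebra.lTensor_counit_comul (R := k) (s : R)

/-- The bialgebra structure of a subalgebra that is stable under the comultiplication. -/
noncomputable abbrev subBialgebra [Bialgebra k R] (S : Subalgebra k R)
    (hS : ∀ s ∈ S, Bialgebra.comulAlgHom k R s ∈ (Algebra.TensorProduct.map S.val S.val).range) :
    Bialgebra k S :=
  .ofAlgHom (subComul S hS) ((Bialgebra.counitAlgHom k R).comp S.val)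
    (subComul_coassoc S hS) (subCounit_rTensor S hS) (subCounit_lTensor S hS)

/-- The Hopf algebra structure of a subalgebra that is stable under the comultiplication and the
antipode. -/
noncomputable abbrev subHopfAlgebra [HopfAlgebra k R] (S : Subalgebra k R)
    (hS : ∀ s ∈ S, Bialgebra.comulAlgHom k R s ∈ (Algebra.TensorProduct.map S.val S.val).range)
    (hS' : ∀ s ∈ S, HopfAlgebra.antipode k s ∈ S) :
    HopfAlgebra k S :=
  letI := subBialgebra S hS
  have hinj : Function.Injective S.val := Subtype.val_injective
  have hv := map_comp_subComul S hS
  .ofAlgHom (((HopfAlgebra.antipodeAlgHom k R).comp S.val).codRestrict S fun s => hS' s s.2)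
    (by
      refine AlgHom.ext fun s => hinj ?_
      have h1 : S.val.comp (Algebra.TensorProduct.lift
          (((HopfAlgebra.antipodeAlgHom k R).comp S.val).codRestrict S fun s => hS' s s.2)
          (.id k S) fun _ _ => Commute.all _ _) =
        ((Algebra.TensorProduct.lmul' k).comp (Algebra.TensorProduct.map
          (HopfAlgebra.antipodeAlgHom k R) (.id k R))).comp
          (Algebra.TensorProduct.map S.val S.val) := by
        ext
        · simp
          rfl
        · simp
      exact (DFunLike.congr_fun h1 (subComul S hS s)).trans ((congrArg
        ((Algebra.TensorProduct.lmul' k).comp (Algebra.TensorProduct.map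
          (HopfAlgebra.antipodeAlgHom k R) (.id k R))) (DFunLike.congr_fun hv s)).trans
        (HopfAlgebra.mul_antipode_rTensor_comul_apply (R := k) (s : R))))
    (by
      refine AlgHom.ext fun s => hinj ?_
      have h1 : S.val.comp (Algebra.TensorProduct.lift (.id k S)
          (((HopfAlgebra.antipodeAlgHom k R).comp S.val).codRestrict S fun s => hS' s s.2)
          fun _ _ => Commute.all _ _) =
        ((Algebra.TensorProduct.lmul' k).comp (Algebra.TensorProduct.map (.id k R)
          (HopfAlgebra.antipodeAlgHom k R))).comp (Algebra.TensorProduct.map S.val S.val) := by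
        ext
        · simp
        · simp
          rfl
      exact (DFunLike.congr_fun h1 (subComul S hS s)).trans ((congrArg
        ((Algebra.TensorProduct.lmul' k).comp (Algebra.TensorProduct.map (.id k R)
          (HopfAlgebra.antipodeAlgHom k R))) (DFunLike.congr_fun hv s)).trans
        (HopfAlgebra.mul_antipode_lTensor_comul_apply (R := k) (s : R))))

end QuotientHopf

/-! ### The Hopf algebra of the quotient group. -/

section QuotientRing

open TensorProduct

variable (k : Type*) [Field k] (Γ : Type*) [CommGroup Γ] [Fintype Γ] [DecidableEq Γ]

/-- On points this is `(xσ)y = (xy)σ`, which uses commutativity. -/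
theorem map_translation_id_comp_comul (σ : Γ) :
    (Algebra.TensorProduct.map (translation k Γ σ) (.id k (UnitsRing k Γ))).comp
      (unitsComul k Γ) = (unitsComul k Γ).comp (translation k Γ σ) := by
  apply unitOf_injective (T := UnitsRing k Γ ⊗[k] UnitsRing k Γ)
  have h1 : (Algebra.TensorProduct.map (translation k Γ σ) (.id k (UnitsRing k Γ))).comp
      Algebra.TensorProduct.includeLeft =
      Algebra.TensorProduct.includeLeft.comp (translation k Γ σ) := by ext; simp
  have h2 : (Algebra.TensorProduct.map (translation k Γ σ) (.id k (UnitsRing k Γ))).comp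
      Algebra.TensorProduct.includeRight = Algebra.TensorProduct.includeRight := by ext; simp
  rw [unitOf_comp_unitsComul, h1, h2, unitOf_comp_translation, unitOf_comp_translation,
    unitsComul, unitOf_unitsLift]
  exact mul_right_comm _ _ _

theorem map_id_translation_comp_comul (σ : Γ) :
    (Algebra.TensorProduct.map (.id k (UnitsRing k Γ)) (translation k Γ σ)).comp
      (unitsComul k Γ) = (unitsComul k Γ).comp (translation k Γ σ) := by
  apply unitOf_injective (T := UnitsRing k Γ ⊗[k] UnitsRing k Γ)
  have h1 : (Algebra.TensorProduct.map (.id k (UnitsRing k Γ)) (translation k Γ σ)).comp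
      Algebra.TensorProduct.includeRight =
      Algebra.TensorProduct.includeRight.comp (translation k Γ σ) := by ext; simp
  have h2 : (Algebra.TensorProduct.map (.id k (UnitsRing k Γ)) (translation k Γ σ)).comp
      Algebra.TensorProduct.includeLeft = Algebra.TensorProduct.includeLeft := by ext; simp
  rw [unitOf_comp_unitsComul, h1, h2, unitOf_comp_translation, unitOf_comp_translation,
    unitsComul, unitOf_unitsLift]
  exact (_root_.mul_assoc _ _ _).symm

/-- The comultiplication of an invariant is fixed by `Γ` on each tensor factor separately. -/
theorem comul_mem_range (s : UnitsRing k Γ) (hs : s ∈ QuotientRing k Γ) :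
    Bialgebra.comulAlgHom k (UnitsRing k Γ) s ∈
      (Algebra.TensorProduct.map (QuotientRing k Γ).val (QuotientRing k Γ).val).range := by
  refine mem_range_map_subtype_of_fixed (Subalgebra.toSubmodule (QuotientRing k Γ))
    (fun σ : Γ => (translation k Γ σ).toLinearMap) (fun v => Iff.rfl) _ (fun σ => ?_) (fun σ => ?_)
  · exact (DFunLike.congr_fun (map_translation_id_comp_comul k Γ σ) s).trans
      (congrArg (unitsComul k Γ) (hs σ))
  · exact (DFunLike.congr_fun (map_id_translation_comp_comul k Γ σ) s).trans
      (congrArg (unitsComul k Γ) (hs σ))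

theorem antipode_mem (s : UnitsRing k Γ) (hs : s ∈ QuotientRing k Γ) :
    HopfAlgebra.antipode k s ∈ QuotientRing k Γ := by
  intro σ
  -- On points: `(xσ)⁻¹ = x⁻¹σ⁻¹`.
  have h : (translation k Γ σ).comp (unitsAntipode k Γ) =
      (unitsAntipode k Γ).comp (translation k Γ σ⁻¹) := by
    apply unitOf_injective
    have h1 := unitOf_unitsAntipode_mul k Γ
    refine (isUnit_unitOf (translation k Γ σ)).mul_right_cancel ?_
    have h2 := congrArg (MonoidAlgebra.mapAlgHom Γ (translation k Γ σ)) h1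
    rw [map_mul, ← unitOf_comp, map_one] at h2
    refine h2.trans ?_
    rw [unitOf_comp_translation, ← AlgHom.id_comp (translation k Γ σ), unitOf_comp_translation,
      unitOf_id, _root_.mul_mul_mul_comm, h1, MonoidAlgebra.single_mul_single,
      inv_mul_cancel, _root_.mul_one, _root_.one_mul, ← MonoidAlgebra.one_def]
  exact (DFunLike.congr_fun h s).trans (congrArg (unitsAntipode k Γ) (hs σ⁻¹))

noncomputable instance : HopfAlgebra k (QuotientRing k Γ) :=
  subHopfAlgebra (QuotientRing k Γ) (comul_mem_range k Γ) (antipode_mem k Γ)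

theorem map_val_comp_comul_quotientRing :
    (Algebra.TensorProduct.map (QuotientRing k Γ).val (QuotientRing k Γ).val).comp
      (Bialgebra.comulAlgHom k (QuotientRing k Γ)) =
      (Bialgebra.comulAlgHom k (UnitsRing k Γ)).comp (QuotientRing k Γ).val :=
  map_comp_subComul _ (comul_mem_range k Γ)

/-- The inclusion of the coordinate ring of the quotient is a morphism of bialgebras. -/
noncomputable def quotientInclusion : QuotientRing k Γ →ₐc[k] UnitsRing k Γ :=
  .ofAlgHom (QuotientRing k Γ).val rfl (map_val_comp_comul_quotientRing k Γ)

instance : Coalgebra.IsCocomm k (QuotientRing k Γ) where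
  comm_comp_comul := by
    have h1 : (Algebra.TensorProduct.map (QuotientRing k Γ).val (QuotientRing k Γ).val).comp
        (Algebra.TensorProduct.comm k (QuotientRing k Γ) (QuotientRing k Γ)).toAlgHom =
        (Algebra.TensorProduct.comm k (UnitsRing k Γ) (UnitsRing k Γ)).toAlgHom.comp
        (Algebra.TensorProduct.map (QuotientRing k Γ).val (QuotientRing k Γ).val) := by
      ext <;> simp
    have hv := map_val_comp_comul_quotientRing k Γ
    refine LinearMap.ext fun s => map_val_injective (QuotientRing k Γ) ?_
    refine (DFunLike.congr_fun h1 (Bialgebra.comulAlgHom k (QuotientRing k Γ) s)).trans ?_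
    exact (congrArg (Algebra.TensorProduct.comm k (UnitsRing k Γ) (UnitsRing k Γ))
      (DFunLike.congr_fun hv s)).trans
      ((Coalgebra.comm_comul k (s : UnitsRing k Γ)).trans (DFunLike.congr_fun hv s).symm)

end QuotientRing

end AbelianCovering

namespace AbelianCovering

/-! ### Torsion freeness over the invariants. -/

section TorsionFree

open Polynomial

/-- A reduced ring with a finite group action is torsion free over its ring of invariants if the
latter is a domain. -/
theorem isTorsionFree_of_isInvariant (Γ : Type*) [Group Γ] [Finite Γ] {A B : Type*} [CommRing A]
    [MulSemiringAction Γ A] [CommRing B] [Algebra B A] [SMulCommClass Γ B A]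
    [Algebra.IsInvariant B A Γ] [IsDomain B] [IsReduced A] (hB : Function.Injective (algebraMap B A)) :
    Module.IsTorsionFree B A := by
  cases nonempty_fintype Γ
  refine Module.isTorsionFree_iff_smul_eq_zero.2 fun b a h => or_iff_not_imp_left.2 fun hb => ?_
  let I : Ideal A := LinearMap.ker (LinearMap.mulLeft A (algebraMap B A b))
  have hI (x : A) : x ∈ I ↔ b • x = 0 := by simp [I, Algebra.smul_def]
  -- All conjugates of `a` are killed by the invariant `b`, so they vanish modulo its annihilator
  -- `I`.
  have h1 : (MulSemiringAction.charpoly Γ a).map (Ideal.Quotient.mk I) = X ^ Fintype.card Γ := by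
    rw [MulSemiringAction.charpoly_eq, Polynomial.map_prod, ← Finset.card_univ,
      ← Finset.prod_const]
    refine Finset.prod_congr rfl fun σ _ => ?_
    have : Ideal.Quotient.mk I (σ • a) = 0 := by
      rw [Ideal.Quotient.eq_zero_iff_mem, hI, ← smul_comm, h, smul_zero]
    simp [this]
  -- The coefficients of the difference are invariant and killed by `b ≠ 0`, hence zero in the
  -- domain `B`. Thus `a` is nilpotent.
  have h2 : MulSemiringAction.charpoly Γ a = X ^ Fintype.card Γ := by
    ext n
    obtain ⟨c, hc⟩ := Algebra.IsInvariant.isInvariant (A := B) (G := Γ)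
      ((MulSemiringAction.charpoly Γ a - X ^ Fintype.card Γ).coeff n) (fun σ => by
        rw [coeff_sub, smul_sub, MulSemiringAction.smul_coeff_charpoly]
        simp [coeff_X_pow, smul_ite])
    have h3 : (MulSemiringAction.charpoly Γ a - X ^ Fintype.card Γ).coeff n ∈ I := by
      rw [← Ideal.Quotient.eq_zero_iff_mem, ← coeff_map, Polynomial.map_sub, h1]
      simp
    rw [← hc, hI, Algebra.smul_def, ← map_mul] at h3
    have h4 : b * c = 0 := hB (by rw [h3, map_zero])
    rw [(mul_eq_zero.1 h4).resolve_left hb, map_zero, coeff_sub, eq_comm, sub_eq_zero] at hc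
    exact hc
  have h3 := MulSemiringAction.eval_charpoly Γ a
  rw [h2, eval_pow, eval_X] at h3
  exact pow_eq_zero_iff (Fintype.card_ne_zero) |>.1 h3

end TorsionFree

/-! ### An element acting trivially on a reduced fibre acts trivially. -/

section Inertia

open Polynomial

variable {A B : Type*} [CommRing A] [CommRing B] [Algebra B A]

/-- If the fibre of a finite algebra over a maximal ideal with perfect residue field is reduced, then
every element of the algebra is modulo that ideal a simple root of a polynomial. -/
theorem exists_separable_of_isRadical [Module.Finite B A] (p : Ideal B) [p.IsMaximal]
    (hp : letI := Ideal.Quotient.field p; PerfectField (B ⧸ p))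
    (hrad : (p.map (algebraMap B A)).IsRadical) (a : A) :
    ∃ (f : B[X]) (v : A), aeval a f ∈ p.map (algebraMap B A) ∧
      v * aeval a (derivative f) - 1 ∈ p.map (algebraMap B A) := by
  let := Ideal.Quotient.field p
  let I := p.map (algebraMap B A)
  have : IsReduced (A ⧸ I) := (Ideal.isRadical_iff_quotient_reduced _).1 hrad
  let : Algebra (B ⧸ p) (A ⧸ I) := Ideal.Quotient.algebraQuotientOfLEComap Ideal.le_comap_map
  have : IsScalarTower B (B ⧸ p) (A ⧸ I) := .of_algebraMap_eq fun _ => rfl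
  have : Module.Finite (B ⧸ p) (A ⧸ I) := Module.Finite.of_restrictScalars_finite B _ _
  let x : A ⧸ I := Ideal.Quotient.mk I a
  have hm : (minpoly (B ⧸ p) x).Separable :=
    PerfectField.separable_iff_squarefree.2
      ((minpoly.isRadical (B ⧸ p) x).squarefree (minpoly.ne_zero (Algebra.IsIntegral.isIntegral x)))
  obtain ⟨u, v, huv⟩ := hm
  obtain ⟨f, hf⟩ := Polynomial.map_surjective (Ideal.Quotient.mk p) Ideal.Quotient.mk_surjective
    (minpoly (B ⧸ p) x)
  obtain ⟨v', hv'⟩ := Ideal.Quotient.mk_surjective (aeval x v)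
  have haeval (g : B[X]) : Ideal.Quotient.mk I (aeval a g) =
      aeval x (g.map (Ideal.Quotient.mk p)) := by
    rw [show Ideal.Quotient.mk p = algebraMap B (B ⧸ p) from rfl, aeval_map_algebraMap]
    exact (aeval_algebraMap_apply (A ⧸ I) a g).symm
  refine ⟨f, v', ?_, ?_⟩
  · rw [← Ideal.Quotient.eq_zero_iff_mem, haeval, hf, minpoly.aeval]
  · rw [← Ideal.Quotient.eq_zero_iff_mem, map_sub, map_mul, hv', haeval, ← derivative_map, hf]
    have := congrArg (aeval x) huv
    simp only [map_add, map_mul, minpoly.aeval, mul_zero, zero_add, map_one] at this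
    rw [this, map_one, sub_self]

variable {Γ : Type*} [Group Γ] [MulSemiringAction Γ A] [SMulCommClass Γ B A]

/-- Elements of `p` are fixed by `σ`, so in `σ(bx) - bx = b(σx - x)` a factor from `p` is gained. -/
theorem smul_sub_mem_of_mem_map {p J : Ideal B} {σ : Γ}
    (h : ∀ a : A, σ • a - a ∈ J.map (algebraMap B A)) {x : A} (hx : x ∈ p.map (algebraMap B A)) :
    σ • x - x ∈ (p * J).map (algebraMap B A) := by
  refine Submodule.span_induction (p := fun x _ => σ • x - x ∈ (p * J).map (algebraMap B A))
    ?_ ?_ ?_ ?_ hx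
  · rintro _ ⟨b, -, rfl⟩
    simp [smul_algebraMap]
  · simp
  · intro x y _ _ hx hy
    rw [smul_add, add_sub_add_comm]
    exact add_mem hx hy
  · intro a x hx hσx
    have h1 : σ • (a • x) - a • x = σ • a * (σ • x - x) + x * (σ • a - a) := by
      rw [smul_eq_mul, smul_mul']; ring
    rw [h1]
    refine add_mem (Ideal.mul_mem_left _ _ hσx) ?_
    rw [Ideal.map_mul]
    exact Ideal.mul_mem_mul hx (h a)

/-- Newton's argument. With `d = σa - a` in `pⁿ⁺¹A`, the previous lemma puts `f(a + d) - f(a)` in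
`pⁿ⁺²A`, and `d²` lies there too. Taylor expansion leaves `f'(a) d`, and `f'(a)` is invertible
modulo `pA`. -/
theorem smul_sub_mem_pow {p : Ideal B} {σ : Γ}
    (hsep : ∀ a : A, ∃ (f : B[X]) (v : A), aeval a f ∈ p.map (algebraMap B A) ∧
      v * aeval a (derivative f) - 1 ∈ p.map (algebraMap B A))
    (hσ : ∀ a : A, σ • a - a ∈ p.map (algebraMap B A)) (n : ℕ) (a : A) :
    σ • a - a ∈ (p ^ (n + 1)).map (algebraMap B A) := by
  induction n generalizing a with
  | zero => simpa using hσ a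
  | succ n ih =>
    obtain ⟨f, v, hf, hv⟩ := hsep a
    let J : Ideal A := (p ^ (n + 2)).map (algebraMap B A)
    let d := σ • a - a
    have h1 : σ • aeval a f - aeval a f ∈ J := by
      have := smul_sub_mem_of_mem_map ih hf
      rwa [← pow_succ'] at this
    have h2 : σ • aeval a f = aeval (a + d) f := by
      have : σ • aeval a f = MulSemiringAction.toAlgHom B A σ (aeval a f) := rfl
      rw [this, ← aeval_algHom_apply]
      simp [d]
    have h3 : d * d ∈ J := by
      have := Ideal.mul_mem_mul (ih a) (ih a)
      rw [← Ideal.map_mul, ← pow_add] at this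
      exact Ideal.map_mono (Ideal.pow_le_pow_right (by lia)) this
    obtain ⟨c, hc⟩ := (f.map (algebraMap B A)).binomExpansion a d
    simp only [derivative_map, eval_map_algebraMap] at hc
    have h4 : aeval a (derivative f) * d ∈ J := by
      have : aeval a (derivative f) * d = (σ • aeval a f - aeval a f) - c * (d * d) := by
        rw [h2, hc]; ring
      rw [this]
      exact sub_mem h1 (J.mul_mem_left _ h3)
    have h5 : (v * aeval a (derivative f) - 1) * d ∈ J := by
      have := Ideal.mul_mem_mul hv (ih a)
      rwa [← Ideal.map_mul, ← pow_succ'] at this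
    have : d = v * (aeval a (derivative f) * d) - (v * aeval a (derivative f) - 1) * d := by ring
    change d ∈ J
    rw [this]
    exact sub_mem (J.mul_mem_left _ h4) h5

/-- A group element that acts trivially on a reduced fibre acts trivially. -/
theorem smul_eq_of_forall_smul_sub_mem [IsDomain B] [IsNoetherianRing B] [Module.Finite B A]
    [Module.IsTorsionFree B A] {p : Ideal B} (hp : p ≠ ⊤) {σ : Γ}
    (hsep : ∀ a : A, ∃ (f : B[X]) (v : A), aeval a f ∈ p.map (algebraMap B A) ∧
      v * aeval a (derivative f) - 1 ∈ p.map (algebraMap B A))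
    (hσ : ∀ a : A, σ • a - a ∈ p.map (algebraMap B A)) (a : A) : σ • a = a := by
  have h := Ideal.iInf_pow_smul_eq_bot_of_isTorsionFree (M := A) p hp
  rw [← sub_eq_zero, ← Submodule.mem_bot B, ← h, Submodule.mem_iInf]
  intro n
  rw [Ideal.smul_top_eq_map]
  exact Ideal.map_mono (Ideal.pow_le_pow_right (by lia)) (smul_sub_mem_pow hsep hσ n a)

end Inertia
end AbelianCovering

namespace AbelianCovering

open scoped Pointwise

/-! ### Local construction of a normal element. -/

section NormalElement

variable {Γ : Type*} [CommGroup Γ] [Fintype Γ] [DecidableEq Γ] {A B : Type*} [CommRing A]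
  [MulSemiringAction Γ A] [CommRing B] [Algebra B A] [SMulCommClass Γ B A]
  [Algebra.IsInvariant B A Γ]

/-- The determinant whose invertibility means that the conjugates of an element form a basis over the
ring of invariants. -/
noncomputable def orbitDet (w : A) : A := (groupMatrix (orbitElement Γ w).coeff).det

-- The primes above `p` are conjugate, and conjugate primes have the same inertia group as `Γ` is
-- abelian. Since `pA` is radical, it is the intersection of these primes.
variable (Γ) in
theorem smul_mem_of_mem_inertia (p : Ideal B) [p.IsMaximal]
    (hrad : (p.map (algebraMap B A)).IsRadical) (Q : Ideal A) [Q.IsPrime] [Q.LiesOver p] {σ : Γ}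
    (hσ : ∀ a : A, σ • a - a ∈ Q) (a : A) : σ • a - a ∈ p.map (algebraMap B A) := by
  rw [← hrad.radical, Ideal.radical_eq_sInf, Ideal.mem_sInf]
  rintro Q' ⟨hQ', hprime⟩
  have h1 : p = Q'.under B := (Ideal.IsMaximal.eq_of_le inferInstance
    (Ideal.IsPrime.ne_top inferInstance) (Ideal.map_le_iff_le_comap.1 hQ'))
  obtain ⟨τ, rfl⟩ := Algebra.IsInvariant.exists_smul_of_under_eq B A Γ Q Q'
    ((Ideal.over_def Q p).symm.trans h1)
  rw [Ideal.mem_pointwise_smul_iff_inv_smul_mem, smul_sub, smul_smul, mul_comm, ← smul_smul]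
  exact hσ _

theorem exists_orbitDet_notMem (p : Ideal B) [p.IsMaximal]
    (hp : letI := Ideal.Quotient.field p; PerfectField (B ⧸ p))
    (Q : Ideal A) [Q.IsMaximal] [Q.LiesOver p] [Module.Finite B A]
    (hinertia : ∀ σ : Γ, (∀ a : A, σ • a - a ∈ Q) → σ = 1) :
    ∃ w : A, orbitDet (Γ := Γ) w ∉ Q := by
  let := Ideal.Quotient.field p
  let := Ideal.Quotient.field Q
  let D := MulAction.stabilizer Γ Q
  let φ := Ideal.Quotient.stabilizerHom Q p Γ
  have hφ : Function.Surjective φ := Ideal.Quotient.stabilizerHom_surjective Γ p Q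
  have : Normal (B ⧸ p) (A ⧸ Q) := Ideal.Quotient.normal Γ p Q
  have : Module.Finite (B ⧸ p) (A ⧸ Q) := Module.Finite.of_restrictScalars_finite B _ _
  have : IsGalois (B ⧸ p) (A ⧸ Q) := ⟨⟩
  have hφinj : Function.Injective φ := by
    refine (injective_iff_map_eq_one φ).2 fun σ hσ => Subtype.ext (hinertia σ fun a => ?_)
    have := DFunLike.congr_fun hσ (Ideal.Quotient.mk Q a)
    rw [← Ideal.Quotient.eq_zero_iff_mem, map_sub, sub_eq_zero]
    exact this
  let b := IsGalois.normalBasis (B ⧸ p) (A ⧸ Q)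
  -- Prime avoidance for the finitely many conjugates of `Q`; `e` makes `w` vanish at all of them
  -- but `Q`.
  obtain ⟨e, he, heQ⟩ : ∃ e : A, (∀ τ : Γ, τ • Q ≠ Q → e ∈ τ • Q) ∧ e ∉ Q := by
    by_contra! h
    have h1 : (Finset.univ.filter (fun τ : Γ => τ • Q ≠ Q)).inf (fun τ : Γ => τ • Q) ≤ Q :=
      fun e he => h e fun τ hτ => by
        rw [Submodule.mem_finsetInf] at he
        exact he τ (by simpa using hτ)
    obtain ⟨τ, hτ, hle⟩ := (Ideal.IsPrime.inf_le' inferInstance).1 h1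
    exact (Finset.mem_filter.1 hτ).2 (smul_eq_of_smul_le hle)
  have he0 : Ideal.Quotient.mk Q e ≠ 0 := by rwa [ne_eq, Ideal.Quotient.eq_zero_iff_mem]
  obtain ⟨w₁, hw₁⟩ := Ideal.Quotient.mk_surjective ((Ideal.Quotient.mk Q e)⁻¹ * b 1)
  have hw : Ideal.Quotient.mk Q (e * w₁) = b 1 := by
    rw [map_mul, hw₁, mul_inv_cancel_left₀ he0]
  have hw' (τ : Γ) (hτ : τ ∉ D) : Ideal.Quotient.mk Q (τ • (e * w₁)) = 0 := by
    rw [Ideal.Quotient.eq_zero_iff_mem, ← Ideal.mem_inv_pointwise_smul_iff]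
    refine Ideal.mul_mem_right _ _ (he _ fun h => hτ ?_)
    exact inv_mem_iff.1 h
  refine ⟨e * w₁, fun hdet => ?_⟩
  rw [← Ideal.Quotient.eq_zero_iff_mem, orbitDet, map_det_groupMatrix,
    ← Matrix.exists_mulVec_eq_zero_iff] at hdet
  obtain ⟨v, hv0, hv⟩ := hdet
  refine hv0 (funext fun τ₀ => ?_)
  -- The row of index `g⁻¹τ₀` of the kernel equation: modulo `Q` only the columns in the coset `Dτ₀`
  -- survive.
  have h1 (g : D) : ∑ h : D, v (h * τ₀) * φ h (b (φ g)) = 0 := by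
    have h2 := congrFun hv ((g : Γ)⁻¹ * τ₀)
    simp only [Matrix.mulVec, dotProduct, groupMatrix, Matrix.of_apply, Function.comp_apply,
      orbitElement, coeff_groupElement, Pi.zero_apply] at h2
    rw [← Equiv.sum_comp (Equiv.mulRight τ₀)] at h2
    let F (h : Γ) : A ⧸ Q := Ideal.Quotient.mk Q ((h * g) • (e * w₁)) * v (h * τ₀)
    have h3 (h : Γ) : ((g : Γ)⁻¹ * τ₀ * (h * τ₀)⁻¹)⁻¹ = h * g := by
      group
    have h4 (h : D) : v (h * τ₀) * φ h (b (φ g)) = F h := by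
      rw [IsGalois.normalBasis_apply, ← hw, _root_.mul_comm]
      refine congrArg (· * _) ?_
      rw [mul_smul]
      rfl
    have h5 : ∑ h : D, F h = ∑ h : Γ, F h := by
      rw [← Finset.sum_subtype (Finset.univ.filter (fun h => h ∈ D)) (by simp) F]
      refine Finset.sum_subset (Finset.subset_univ _) fun h _ hh => ?_
      have : h * g ∉ D := fun hg => hh (by simpa using (D.mul_mem_cancel_right g.2).1 hg)
      simp only [F, hw' _ this, zero_mul]
    rw [Finset.sum_congr rfl fun h _ => h4 h, h5, ← h2]
    refine Finset.sum_congr rfl fun h _ => ?_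
    simp only [F, Equiv.coe_mulRight, h3]
  have h2 : ∑ h : D, v (h * τ₀) • ((φ h : (A ⧸ Q) ≃ₐ[B ⧸ p] (A ⧸ Q)) :
      (A ⧸ Q) →ₗ[B ⧸ p] (A ⧸ Q)) = 0 := by
    refine b.ext fun e => ?_
    obtain ⟨g, rfl⟩ := hφ e
    simpa using h1 g
  -- By `h2`, a combination of the automorphisms `φ h` vanishes on a basis, hence everywhere;
  -- Dedekind's independence of characters makes its coefficients zero.
  have h3 := (linearIndependent_monoidHom (A ⧸ Q) (A ⧸ Q)).comp
    (fun h : D => ((φ h : (A ⧸ Q) ≃ₐ[B ⧸ p] (A ⧸ Q)) : (A ⧸ Q) →* (A ⧸ Q)))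
    (fun h h' hh => hφinj (AlgEquiv.ext fun x => DFunLike.congr_fun hh x))
  rw [Fintype.linearIndependent_iff] at h3
  have h4 := h3 (fun h => v (h * τ₀)) (funext fun x => by
    simpa using LinearMap.congr_fun h2 x) 1
  simpa using h4

-- Determinants in `map_smul_orbitElement`: `u` is the determinant of multiplication by `σ`.
variable (Γ) in
theorem smul_orbitDet (σ : Γ) (w : A) : ∃ u : A, IsUnit u ∧
    σ • orbitDet (Γ := Γ) w = orbitDet (Γ := Γ) w * u := by
  refine ⟨(groupMatrix (MonoidAlgebra.single σ (1 : A)).coeff).det,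
    (isUnit_iff_isUnit_det_groupMatrix _).1 (isUnit_single σ), ?_⟩
  rw [orbitDet, ← Matrix.det_mul, ← groupMatrix_mul, ← map_smul_orbitElement]
  refine (map_det_groupMatrix (MulSemiringAction.toRingHom Γ A σ) _).trans ?_
  rfl

variable (Γ) in
/-- The orbit determinant divides an invariant element outside a given prime. -/
theorem exists_orbitDet_dvd (p : Ideal B) (Q : Ideal A) [Q.IsPrime] [Q.LiesOver p] {w : A}
    (hw : orbitDet (Γ := Γ) w ∉ Q) :
    ∃ N : B, N ∉ p ∧ orbitDet (Γ := Γ) w ∣ algebraMap B A N := by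
  obtain ⟨N, hN⟩ := Algebra.IsInvariant.isInvariant (A := B) (G := Γ)
    (∏ σ : Γ, σ • orbitDet (Γ := Γ) w) (Finset.smul_prod_perm _)
  refine ⟨N, fun h => ?_, ?_⟩
  · rw [Ideal.over_def Q p, Ideal.mem_comap, hN, Ideal.IsPrime.prod_mem_iff] at h
    obtain ⟨σ, -, hσ⟩ := h
    obtain ⟨u, hu, h⟩ := smul_orbitDet Γ σ w
    rw [h, Ideal.mul_unit_mem_iff_mem _ hu] at hσ
    exact hw hσ
  · rw [hN]
    simpa using Finset.dvd_prod_of_mem (fun σ : Γ => σ • orbitDet (Γ := Γ) w) (Finset.mem_univ 1)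

/-- If the fibre over a closed point of the quotient by a finite abelian group is reduced, then near
that point the conjugates of a suitable function form a basis over the invariant functions. -/
theorem exists_orbitDet_dvd_of_isRadical {k : Type*} [Field k] [PerfectField k] [Algebra k B]
    [Algebra.FiniteType k B] [IsDomain B] [IsReduced A] [Module.Finite B A] [FaithfulSMul Γ A]
    (hB : Function.Injective (algebraMap B A)) (p : Ideal B) [p.IsMaximal]
    (hrad : (p.map (algebraMap B A)).IsRadical) :
    ∃ (w : A) (N : B), N ∉ p ∧ orbitDet (Γ := Γ) w ∣ algebraMap B A N := by
  have : IsNoetherianRing B := Algebra.FiniteType.isNoetherianRing k B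
  have := isTorsionFree_of_isInvariant Γ hB
  have hp : letI := Ideal.Quotient.field p; PerfectField (B ⧸ p) := by
    let := Ideal.Quotient.field p
    have : Module.Finite k (B ⧸ p) := finite_of_finite_type_of_isJacobsonRing k (B ⧸ p)
    exact Algebra.IsAlgebraic.perfectField (K := k)
  obtain ⟨Q, hQ, hQp⟩ := Ideal.exists_ideal_over_maximal_of_isIntegral (S := A) p
    (by rw [(RingHom.injective_iff_ker_eq_bot _).1 hB]; exact bot_le)
  have : Q.LiesOver p := ⟨hQp.symm⟩
  obtain ⟨w, hw⟩ := exists_orbitDet_notMem (Γ := Γ) p hp Q fun σ hσ => by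
    refine FaithfulSMul.eq_of_smul_eq_smul (α := A) fun a => ?_
    rw [one_smul]
    exact smul_eq_of_forall_smul_sub_mem (p := p) (Ideal.IsPrime.ne_top inferInstance)
      (exists_separable_of_isRadical p hp hrad) (smul_mem_of_mem_inertia Γ p hrad Q hσ) a
  exact ⟨w, exists_orbitDet_dvd Γ p Q hw⟩

end NormalElement
end AbelianCovering

namespace AbelianCovering

/-! ### Invariants and localization. -/

section Localization

variable {S R S' R' : Type*} [CommRing S] [CommRing R] [CommRing S'] [CommRing R']
  [Algebra S S'] [Algebra R R'] (φ : S →+* R) (φ' : S' →+* R')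

theorem injective_of_isLocalization_away (f : S)
    [IsLocalization.Away f S'] [IsLocalization.Away (φ f) R']
    (hφ : ∀ s, φ' (algebraMap S S' s) = algebraMap R R' (φ s)) (h : Function.Injective φ) :
    Function.Injective φ' := by
  rw [injective_iff_map_eq_zero]
  intro x hx
  obtain ⟨⟨s, ⟨_, n, rfl⟩⟩, hs⟩ := IsLocalization.surj (Submonoid.powers f) x
  have h0 : algebraMap R R' (φ s) = 0 := by
    rw [← hφ, ← hs, map_mul, hx, zero_mul]
  obtain ⟨⟨_, m, rfl⟩, hm⟩ :=
    (IsLocalization.map_eq_zero_iff (Submonoid.powers (φ f)) R' _).1 h0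
  have h1 : f ^ m * s = 0 := h (by simpa using hm)
  have hu : ∀ j, IsUnit (algebraMap S S' (f ^ j)) := fun j =>
    IsLocalization.map_units S' (⟨f ^ j, j, rfl⟩ : Submonoid.powers f)
  have h2 : algebraMap S S' s = 0 := by
    refine (hu m).mul_left_cancel ?_
    rw [← map_mul, h1, map_zero, mul_zero]
  refine (hu n).mul_right_cancel ?_
  rw [hs, h2, zero_mul]

/-- Invariants of a finite family commute with localization: after clearing the denominator of `x`,
one power of `φ f` kills all the differences `e i r - r`. -/
theorem mem_range_of_isLocalization_away (f : S)
    [IsLocalization.Away f S'] [IsLocalization.Away (φ f) R'] {I : Type*} [Finite I] (e : I → R →+* R)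
    (e' : I → R' →+* R') (hφ : ∀ s, φ' (algebraMap S S' s) = algebraMap R R' (φ s))
    (he : ∀ i r, e' i (algebraMap R R' r) = algebraMap R R' (e i r))
    (hφe : ∀ i s, e i (φ s) = φ s)
    (h : ∀ r, (∀ i, e i r = r) → r ∈ Set.range φ) (x : R') (hx : ∀ i, e' i x = x) :
    x ∈ Set.range φ' := by
  cases nonempty_fintype I
  obtain ⟨⟨r, ⟨_, n, rfl⟩⟩, hr⟩ := IsLocalization.surj (Submonoid.powers (φ f)) x
  have hr' : x * algebraMap R R' (φ f ^ n) = algebraMap R R' r := hr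
  have h0 : ∀ i, ∃ m : ℕ, φ f ^ m * (e i r - r) = 0 := by
    intro i
    have h0 : algebraMap R R' (e i r - r) = 0 := by
      rw [map_sub, ← he, ← hr', map_mul, hx, he, map_pow, hφe, sub_self]
    obtain ⟨⟨_, m, rfl⟩, hm⟩ :=
      (IsLocalization.map_eq_zero_iff (Submonoid.powers (φ f)) R' _).1 h0
    exact ⟨m, hm⟩
  choose m hm using h0
  let M := ∑ i, m i
  have hM : ∀ i, φ f ^ M * (e i r - r) = 0 := by
    intro i
    obtain ⟨c, hc⟩ := Nat.exists_eq_add_of_le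
      (Finset.single_le_sum (f := m) (fun _ _ => Nat.zero_le _) (Finset.mem_univ i))
    change φ f ^ (∑ i, m i) * _ = 0
    rw [hc, pow_add, _root_.mul_right_comm, hm, zero_mul]
  obtain ⟨s, hs⟩ := h (φ f ^ M * r) fun i => by
    rw [map_mul, map_pow, hφe, ← sub_eq_zero, ← mul_sub, hM]
  have hu : IsUnit (algebraMap S S' (f ^ (M + n))) :=
    IsLocalization.map_units S' (⟨f ^ (M + n), _, rfl⟩ : Submonoid.powers f)
  refine ⟨algebraMap S S' s * ↑hu.unit⁻¹, ?_⟩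
  refine (hu.map φ').mul_right_cancel ?_
  rw [← map_mul, _root_.mul_assoc, hu.val_inv_mul, _root_.mul_one, hφ, hs, hφ, map_mul, ← hr', map_pow φ,
    pow_add, map_mul]
  ring

end Localization

/-! ### Galois coverings of affine schemes, checked on global functions. -/

section Sections

variable {V W : Scheme.{u}} (π : W ⟶ V)

/-- The ring endomorphism of the functions on `π⁻¹(U)` induced by an automorphism over `V`. -/
def autApp (σ : Aut (Over.mk π)) (U : V.Opens) : Γ(W, π ⁻¹ᵁ U) →+* Γ(W, π ⁻¹ᵁ U) :=
  (σ.hom.left.appLE _ _ (preimage_le π σ U)).hom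

theorem autApp_app (σ : Aut (Over.mk π)) (U : V.Opens) (s : Γ(V, U)) :
    autApp π σ U (π.app U s) = π.app U s := by
  have key : ∀ (f : W ⟶ V) (e : π ⁻¹ᵁ U ≤ f ⁻¹ᵁ U), f = π → f.appLE U (π ⁻¹ᵁ U) e = π.app U := by
    rintro _ _ rfl
    exact Scheme.Hom.appLE_eq_app _
  exact congr($((Scheme.Hom.comp_appLE σ.hom.left π U (π ⁻¹ᵁ U) (preimage_le π σ U)).symm.trans
    (key _ _ (Over.w σ.hom))) s)

theorem autApp_map (σ : Aut (Over.mk π)) {U U' : V.Opens} (i : U' ≤ U) (s : Γ(W, π ⁻¹ᵁ U)) :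
    autApp π σ U' (W.presheaf.map (homOfLE (π.preimage_mono i)).op s) =
      W.presheaf.map (homOfLE (π.preimage_mono i)).op (autApp π σ U s) := by
  exact congr($((σ.hom.left.map_appLE (preimage_le π σ U') _).trans
    (σ.hom.left.appLE_map (preimage_le π σ U) _).symm) s)

theorem app_map {U U' : V.Opens} (i : U' ≤ U) (s : Γ(V, U)) :
    π.app U' (V.presheaf.map (homOfLE i).op s) =
      W.presheaf.map (homOfLE (π.preimage_mono i)).op (π.app U s) := by
  exact congr($(π.naturality (homOfLE i).op) s)

theorem autApp_one (U : V.Opens) (s : Γ(W, π ⁻¹ᵁ U)) : autApp π 1 U s = s := by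
  change (Scheme.Hom.appLE (𝟙 W) _ _ _) s = s
  rw [Scheme.Hom.appLE, Scheme.Hom.id_app]
  exact congr($(W.presheaf.map_id _) s)

/-- Pullback of functions reverses the order; for commutative `Γ` this still gives a left action. -/
theorem autApp_mul (σ τ : Aut (Over.mk π)) (U : V.Opens) (s : Γ(W, π ⁻¹ᵁ U)) :
    autApp π (σ * τ) U s = autApp π τ U (autApp π σ U s) := by
  exact congr($((Scheme.Hom.appLE_comp_appLE τ.hom.left σ.hom.left _ _ _ (preimage_le π σ U)
    (preimage_le π τ U)).symm) s)

section AffineBase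

variable [IsAffine V] [IsAffineHom π]

theorem isAffineOpen_preimage_top : IsAffineOpen (π ⁻¹ᵁ (⊤ : V.Opens)) :=
  (isAffineOpen_top V).preimage π

theorem isLocalization_app_basicOpen (f : Γ(V, ⊤)) :
    @IsLocalization.Away _ _ (π.app ⊤ f) Γ(W, π ⁻¹ᵁ (V.basicOpen f)) _
      (W.presheaf.map (homOfLE (π.preimage_mono (V.basicOpen_le f))).op).hom.toAlgebra :=
  (isAffineOpen_preimage_top π).isLocalization_of_eq_basicOpen _ _
    (Scheme.preimage_basicOpen π f)

theorem exists_basicOpen_cover (U : V.Opens) :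
    ∃ f : U → Γ(V, ⊤), (∀ x, V.basicOpen (f x) ≤ U) ∧ U ≤ ⨆ x, V.basicOpen (f x) := by
  choose f hf hx using fun x : U =>
    (isAffineOpen_top V).exists_basicOpen_le x (TopologicalSpace.Opens.mem_top x.1)
  exact ⟨f, hf, fun x hxU => TopologicalSpace.Opens.mem_iSup.2 ⟨⟨x, hxU⟩, hx ⟨x, hxU⟩⟩⟩

theorem injective_app_of_isAffine (h : Function.Injective (π.app ⊤)) (U : V.Opens) :
    Function.Injective (π.app U) := by
  obtain ⟨f, hf, hU⟩ := exists_basicOpen_cover U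
  intro s t hst
  refine V.sheaf.eq_of_locally_eq' _ U (fun x => homOfLE (hf x)) hU s t fun x => ?_
  let := (V.presheaf.map (homOfLE (V.basicOpen_le (f x))).op).hom.toAlgebra
  let := (W.presheaf.map (homOfLE (π.preimage_mono (V.basicOpen_le (f x)))).op).hom.toAlgebra
  have h1 : IsLocalization.Away (f x) Γ(V, V.basicOpen (f x)) :=
    (isAffineOpen_top V).isLocalization_of_eq_basicOpen _ _ rfl
  have h2 : IsLocalization.Away ((π.app ⊤).hom (f x)) Γ(W, π ⁻¹ᵁ (V.basicOpen (f x))) :=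
    isLocalization_app_basicOpen π (f x)
  refine injective_of_isLocalization_away (π.app ⊤).hom (π.app (V.basicOpen (f x))).hom (f x)
    (fun s => app_map π (V.basicOpen_le (f x)) s) h ?_
  exact (app_map π (hf x) s).trans ((congrArg _ hst).trans (app_map π (hf x) t).symm)

/-- Preimages exist on basic opens by localization; they agree on overlaps by injectivity, and so
glue. -/
theorem range_app_of_isAffine {I : Type*} [Finite I] (e : I → Aut (Over.mk π))
    (h : Function.Injective (π.app ⊤))
    (h' : ∀ s : Γ(W, π ⁻¹ᵁ ⊤), (∀ i, autApp π (e i) ⊤ s = s) → s ∈ Set.range (π.app ⊤))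
    (U : V.Opens) (s : Γ(W, π ⁻¹ᵁ U)) (hs : ∀ i, autApp π (e i) U s = s) :
    s ∈ Set.range (π.app U) := by
  obtain ⟨f, hf, hU⟩ := exists_basicOpen_cover U
  have hloc : ∀ x, W.presheaf.map (homOfLE (π.preimage_mono (hf x))).op s ∈
      Set.range (π.app (V.basicOpen (f x))) := by
    intro x
    let := (V.presheaf.map (homOfLE (V.basicOpen_le (f x))).op).hom.toAlgebra
    let := (W.presheaf.map (homOfLE (π.preimage_mono (V.basicOpen_le (f x)))).op).hom.toAlgebra
    have h1 : IsLocalization.Away (f x) Γ(V, V.basicOpen (f x)) :=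
      (isAffineOpen_top V).isLocalization_of_eq_basicOpen _ _ rfl
    have h2 : IsLocalization.Away ((π.app ⊤).hom (f x)) Γ(W, π ⁻¹ᵁ (V.basicOpen (f x))) :=
      isLocalization_app_basicOpen π (f x)
    refine mem_range_of_isLocalization_away (π.app ⊤).hom (π.app (V.basicOpen (f x))).hom (f x)
      (fun i => autApp π (e i) ⊤) (fun i => autApp π (e i) (V.basicOpen (f x)))
      (fun s => app_map π (V.basicOpen_le (f x)) s)
      (fun i r => autApp_map π (e i) (V.basicOpen_le (f x)) r) (fun i s => autApp_app π (e i) ⊤ s)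
      h' _ fun i => ?_
    exact (autApp_map π (e i) (hf x) s).trans (congrArg _ (hs i))
  choose t ht using hloc
  obtain ⟨r, hr, -⟩ := V.sheaf.existsUnique_gluing' (fun x => V.basicOpen (f x)) U
    (fun x => homOfLE (hf x)) hU t fun x y => by
      refine injective_app_of_isAffine π h _ ?_
      refine (app_map π inf_le_left _).trans (Eq.trans ?_ (app_map π inf_le_right _).symm)
      rw [ht, ht, ← ConcreteCategory.comp_apply, ← ConcreteCategory.comp_apply,
        ← Functor.map_comp, ← Functor.map_comp]
      rfl
  refine ⟨r, W.sheaf.eq_of_locally_eq' (fun x => π ⁻¹ᵁ V.basicOpen (f x)) (π ⁻¹ᵁ U)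
    (fun x => homOfLE (π.preimage_mono (hf x))) ?_ _ _ fun x => ?_⟩
  · rw [← Scheme.Hom.preimage_iSup]
    exact π.preimage_mono hU
  · exact (app_map π (hf x) r).symm.trans ((congrArg _ (hr x)).trans (ht x))

theorem isGaloisCovering_of_isAffine {Γ : Type u} [Group Γ] [Finite Γ] (ρ : Γ →* Aut (Over.mk π))
    (hρ : Function.Injective ρ) (h : Function.Injective (π.app ⊤))
    (h' : ∀ s : Γ(W, π ⁻¹ᵁ ⊤), (∀ σ, autApp π (ρ σ) ⊤ s = s) → s ∈ Set.range (π.app ⊤)) :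
    IsGaloisCovering π ρ where
  finite := inferInstance
  isAffineHom := inferInstance
  injective_app := injective_app_of_isAffine π h
  range_app U := by
    refine Set.Subset.antisymm ?_ fun s hs => range_app_of_isAffine π ρ h h' U s hs
    rintro _ ⟨s, rfl⟩ σ
    exact autApp_app π (ρ σ) U s
  faithful := hρ

end AffineBase

end Sections

end AbelianCovering

namespace AbelianCovering

/-! ### The covering of spectra defined by a ring of invariants. -/

section SpecAction

variable (S R : Type u) [CommRing S] [CommRing R] [Algebra S R] (Γ : Type u) [CommGroup Γ]
  [MulSemiringAction Γ R] [SMulCommClass Γ S R]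

theorem algebraMap_comp_toRingHom (σ : Γ) :
    CommRingCat.ofHom (algebraMap S R) ≫ CommRingCat.ofHom (MulSemiringAction.toRingHom Γ R σ) =
      CommRingCat.ofHom (algebraMap S R) := by
  ext s
  exact smul_algebraMap σ s

/-- The action of `Γ` on `Spec R` over `Spec S`. -/
noncomputable def specAction : Γ →* Aut (Over.mk (Spec.map (CommRingCat.ofHom (algebraMap S R)))) where
  toFun σ :=
    { hom := Over.homMk (Spec.map (CommRingCat.ofHom (MulSemiringAction.toRingHom Γ R σ))) (by
        dsimp
        rw [← Spec.map_comp, algebraMap_comp_toRingHom])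
      inv := Over.homMk (Spec.map (CommRingCat.ofHom (MulSemiringAction.toRingHom Γ R σ⁻¹))) (by
        dsimp
        rw [← Spec.map_comp, algebraMap_comp_toRingHom])
      hom_inv_id := by
        ext1
        refine (Spec.map_comp _ _).symm.trans ((congrArg Spec.map ?_).trans (Spec.map_id _))
        ext r
        simp
      inv_hom_id := by
        ext1
        refine (Spec.map_comp _ _).symm.trans ((congrArg Spec.map ?_).trans (Spec.map_id _))
        ext r
        simp }
  map_one' := by
    ext1
    ext1
    refine (congrArg Spec.map ?_).trans (Spec.map_id _)
    ext r
    simp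
  map_mul' σ τ := by
    ext1
    ext1
    refine Eq.trans (congrArg Spec.map ?_) (Spec.map_comp _ _)
    ext r
    simp [_root_.mul_comm σ τ, mul_smul]

theorem specMap_app_top {A B : CommRingCat.{u}} (f : A ⟶ B) (s : Γ(Spec A, ⊤)) :
    (Spec.map f).app ⊤ s = (Scheme.ΓSpecIso B).inv (f ((Scheme.ΓSpecIso A).hom s)) := by
  have := congr($(Scheme.ΓSpecIso_inv_naturality f) ((Scheme.ΓSpecIso A).hom s))
  simp only [CommRingCat.comp_apply, Iso.hom_inv_id_apply] at this
  exact this.symm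

theorem isGaloisCovering_specAction [Finite Γ] [Algebra.IsInvariant S R Γ] [FaithfulSMul Γ R]
    (hinj : Function.Injective (algebraMap S R)) :
    IsGaloisCovering (Spec.map (CommRingCat.ofHom (algebraMap S R))) (specAction S R Γ) := by
  refine isGaloisCovering_of_isAffine _ _ ?_ ?_ ?_
  · intro σ τ h
    have h1 := Spec.map_injective (congrArg (fun a => a.hom.left) h)
    refine FaithfulSMul.eq_of_smul_eq_smul (α := R) fun r => ?_
    exact congr($h1 r)
  · intro s t hst
    rw [specMap_app_top, specMap_app_top] at hst
    have := hinj ((ConcreteCategory.bijective_of_isIso (Scheme.ΓSpecIso (.of R)).inv).1 hst)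
    exact (ConcreteCategory.bijective_of_isIso (Scheme.ΓSpecIso (.of S)).hom).1 this
  · intro s hs
    obtain ⟨r, rfl⟩ := (ConcreteCategory.bijective_of_isIso (Scheme.ΓSpecIso (.of R)).inv).2 s
    obtain ⟨x, hx⟩ := Algebra.IsInvariant.isInvariant (A := S) (G := Γ) r fun σ => by
      have h1 := hs σ
      have h2 : autApp (Spec.map (CommRingCat.ofHom (algebraMap S R))) (specAction S R Γ σ) ⊤
          ((Scheme.ΓSpecIso (.of R)).inv r) = (Scheme.ΓSpecIso (.of R)).inv (σ • r) := by
        have := specMap_app_top (CommRingCat.ofHom (MulSemiringAction.toRingHom Γ R σ))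
          ((Scheme.ΓSpecIso (.of R)).inv r)
        rw [Iso.inv_hom_id_apply] at this
        refine Eq.trans ?_ this
        exact congr($(Scheme.Hom.appLE_eq_app
          (Spec.map (CommRingCat.ofHom (MulSemiringAction.toRingHom Γ R σ)))) ((Scheme.ΓSpecIso (.of R)).inv r))
      exact (ConcreteCategory.bijective_of_isIso (Scheme.ΓSpecIso (.of R)).inv).1 (h2.symm.trans h1)
    refine ⟨(Scheme.ΓSpecIso (.of S)).inv x, ?_⟩
    rw [specMap_app_top, Iso.inv_hom_id_apply]
    exact congrArg _ hx

theorem specAction_surjective (h : ∀ e : R ≃ₐ[S] R, ∃ σ : Γ, ∀ r, e r = σ • r) :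
    Function.Surjective (specAction S R Γ) := by
  intro a
  have key : ∀ b : Over.mk (Spec.map (CommRingCat.ofHom (algebraMap S R))) ⟶
      Over.mk (Spec.map (CommRingCat.ofHom (algebraMap S R))), ∃ f : R →ₐ[S] R,
      b.left = Spec.map (CommRingCat.ofHom f.toRingHom) := by
    intro b
    have hb : b.left ≫ Spec.map (CommRingCat.ofHom (algebraMap S R)) =
      Spec.map (CommRingCat.ofHom (algebraMap S R)) := Over.w b
    obtain ⟨f, hf⟩ := Spec.map_surjective (R := .of R) (S := .of R) b.left
    rw [← hf, ← Spec.map_comp] at hb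
    have hb' := Spec.map_injective hb
    exact ⟨{ f.hom with commutes' := fun s => congr($hb' s) }, hf.symm⟩
  obtain ⟨f, hf⟩ := key a.hom
  obtain ⟨g, hg⟩ := key a.inv
  have h1 : a.inv.left ≫ a.hom.left = 𝟙 _ := congrArg (fun a => a.left) a.inv_hom_id
  have h2 : a.hom.left ≫ a.inv.left = 𝟙 _ := congrArg (fun a => a.left) a.hom_inv_id
  rw [hf, hg] at h1 h2
  have h1' := Spec.map_injective (((Spec.map_comp _ _).trans h1).trans (Spec.map_id _).symm)
  have h2' := Spec.map_injective (((Spec.map_comp _ _).trans h2).trans (Spec.map_id _).symm)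
  obtain ⟨σ, hσ⟩ := h (AlgEquiv.ofAlgHom f g (AlgHom.ext fun r => congr($h2' r))
    (AlgHom.ext fun r => congr($h1' r)))
  refine ⟨σ, ?_⟩
  ext1
  ext1
  rw [hf]
  refine congrArg Spec.map ?_
  ext r
  exact (hσ r).symm

end SpecAction

/-! ### The isogeny from the group of units to its quotient. -/

section Isogeny

variable (k : Type u) [Field k] (Γ : Type u) [CommGroup Γ] [Fintype Γ] [DecidableEq Γ]

/-- The algebraic group of units of the group algebra of `Γ`. -/
noncomputable abbrev UnitsGroup : Over (Spec (.of k)) :=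
  (Spec (.of (UnitsRing k Γ))).asOver (Spec (.of k))

/-- The quotient of the algebraic group of units of the group algebra of `Γ` by `Γ`. -/
noncomputable abbrev QuotientGroup : Over (Spec (.of k)) :=
  (Spec (.of (QuotientRing k Γ))).asOver (Spec (.of k))

/-- The quotient map from the units of the group algebra to their quotient by `Γ`. -/
noncomputable def quotientHom : UnitsGroup k Γ ⟶ QuotientGroup k Γ :=
  Over.homMk (Spec.map (CommRingCat.ofHom (algebraMap (QuotientRing k Γ) (UnitsRing k Γ))))
    (Spec.map_comp _ _).symm

theorem isVariety_spec_asOver (A : Type u) [CommRing A] [IsDomain A] [Algebra k A]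
    [Algebra.FiniteType k A] : IsVariety ((Spec (.of A)).asOver (Spec (.of k))) where
  isReduced := inferInstanceAs (IsReduced (Spec (.of A)))
  isSeparated := inferInstanceAs (IsSeparated (Spec.map (CommRingCat.ofHom (algebraMap k A))))
  locallyOfFiniteType := inferInstanceAs (LocallyOfFiniteType (Spec (.of A) ↘ Spec (.of k)))
  quasiCompact := inferInstanceAs (QuasiCompact (Spec.map (CommRingCat.ofHom (algebraMap k A))))

theorem isConnectedCommAlgebraicGroup_spec_asOver (A : Type u) [CommRing A] [IsDomain A]
    [HopfAlgebra k A] [Algebra.FiniteType k A] [Coalgebra.IsCocomm k A] :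
    IsConnectedCommAlgebraicGroup ((Spec (.of A)).asOver (Spec (.of k))) where
  isVariety := isVariety_spec_asOver k A
  connected := inferInstanceAs (ConnectedSpace (Spec (.of A)))
  comm := inferInstance

instance : IsMonHom (quotientHom k Γ) :=
  ((bialgSpec (.of k)).map (.op (CommBialgCat.ofHom (quotientInclusion k Γ)))).isMonHom_hom

instance : IsFinite (quotientHom k Γ).left := by
  refine (IsFinite.SpecMap_iff _).2 ?_
  exact RingHom.finite_algebraMap.2 inferInstance

theorem isAbelianIsogeny_quotientHom : IsAbelianIsogeny (quotientHom k Γ)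
    (specAction (QuotientRing k Γ) (UnitsRing k Γ) Γ) where
  source := isConnectedCommAlgebraicGroup_spec_asOver k _
  target := isConnectedCommAlgebraicGroup_spec_asOver k _
  isMonHom := inferInstance
  surjective := ⟨Algebra.IsIntegral.comap_surjective (QuotientRing k Γ) (UnitsRing k Γ)⟩
  finite_kernel := inferInstance
  isGaloisCovering := isGaloisCovering_specAction _ _ _ Subtype.val_injective
  surjective_aut := specAction_surjective _ _ _ fun e => by
    obtain ⟨σ, rfl⟩ := (IsGaloisGroup.mulEquivAlgEquiv Γ (QuotientRing k Γ)
      (UnitsRing k Γ)).surjective e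
    exact ⟨σ, fun r => rfl⟩

end Isogeny

end AbelianCovering

/-! ### Reduced fibres, and the map classified by an orbit element. -/

namespace AbelianCovering

-- If a power of `a` lies in `pA`, then `1 ⊗ a` is nilpotent in the fibre, hence zero. As `p` is
-- maximal, its residue field is `B / p`, and the fibre maps to `A / pA` sending `1 ⊗ a` to the
-- class of `a`.
open TensorProduct in
theorem isRadical_map_of_isReduced_fiber {B A : Type*} [CommRing B] [CommRing A] [Algebra B A]
    (p : Ideal B) [p.IsMaximal] (h : IsReduced (p.Fiber A)) :
    (p.map (algebraMap B A)).IsRadical := by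
  rintro a ⟨n, hn⟩
  let I := p.map (algebraMap B A)
  let e := RingEquiv.ofBijective _ p.bijective_algebraMap_quotient_residueField
  have he (b : B) : e.symm (algebraMap B p.ResidueField b) = Ideal.Quotient.mk p b := by
    rw [e.symm_apply_eq]
    rfl
  let φ : p.ResidueField →ₐ[B] A ⧸ I :=
    { ((Ideal.quotientMap I (algebraMap B A) Ideal.le_comap_map).comp e.symm.toRingHom) with
      commutes' := fun b => by
        change Ideal.quotientMap I (algebraMap B A) Ideal.le_comap_map (e.symm _) = _
        rw [he]
        rfl }
  let ψ : p.Fiber A →ₐ[B] A ⧸ I :=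
    Algebra.TensorProduct.lift φ (Ideal.Quotient.mkₐ B I) fun _ _ => Commute.all _ _
  have hI : I ≤ RingHom.ker (Algebra.TensorProduct.includeRight (R := B) (A := p.ResidueField)
      (B := A)) := by
    rw [Ideal.map_le_iff_le_comap]
    intro b hb
    change Algebra.TensorProduct.includeRight (algebraMap B A b) = 0
    rw [AlgHom.commutes, Algebra.TensorProduct.algebraMap_apply,
      Ideal.algebraMap_residueField_eq_zero.2 hb, zero_tmul]
  have h0 : (1 : p.ResidueField) ⊗ₜ[B] a = 0 := by
    refine (h.eq_zero _ ⟨n, ?_⟩ : (1 ⊗ₜ[B] a : p.Fiber A) = 0)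
    have := hI hn
    rw [RingHom.mem_ker, map_pow] at this
    exact this
  have := congrArg ψ h0
  rw [map_zero, Algebra.TensorProduct.lift_tmul, map_one, _root_.one_mul] at this
  exact Ideal.Quotient.eq_zero_iff_mem.1 this

section Classifying

variable {k : Type u} [Field k] {Γ : Type u} [CommGroup Γ] [Fintype Γ] [DecidableEq Γ]
  {B A : Type u} [CommRing B] [CommRing A] [Algebra k B] [Algebra k A] [Algebra B A]
  [IsScalarTower k B A] [MulSemiringAction Γ A] [SMulCommClass Γ B A] [Algebra.IsInvariant B A Γ]

theorem unitsLift_orbitElement_smul [SMulCommClass Γ k A] {w : A} (hw : IsUnit (orbitElement Γ w)) (σ : Γ)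
    (x : UnitsRing k Γ) :
    unitsLift (k := k) (orbitElement Γ w) hw (σ • x) =
      σ • unitsLift (k := k) (orbitElement Γ w) hw x := by
  have h : (unitsLift (k := k) (orbitElement Γ w) hw).comp (MulSemiringAction.toAlgHom k _ σ) =
      (MulSemiringAction.toAlgHom k A σ).comp (unitsLift (orbitElement Γ w) hw) := by
    apply unitsRing_algHom_ext
    ext τ
    simp only [universalUnit, MonoidAlgebra.coeff_mapAlgHom, coeff_groupElement,
      AlgHom.comp_apply, MulSemiringAction.toAlgHom_apply, smul_coord, unitsLift_coord,
      orbitElement, coeff_groupElement, smul_smul]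
    simp [_root_.mul_comm]
  exact DFunLike.congr_fun h x

theorem unitsBasis_apply (σ : Γ) : unitsBasis k Γ σ = σ • coord k Γ 1 :=
  orbitBasis_apply _ _ σ

/-- `φ` classifies the orbit element of `w`. By equivariance it maps invariants into `B`, and it
sends the basis of translates of the coordinate at `1` to the basis of conjugates of `w`. -/
theorem exists_isPushout_unitsRing (hB : Function.Injective (algebraMap B A)) {w : A}
    (hw : IsUnit (orbitElement Γ w)) :
    ∃ (φ : UnitsRing k Γ →ₐ[k] A) (ψ : QuotientRing k Γ →ₐ[k] B),
      (∀ (σ : Γ) x, φ (σ • x) = σ • φ x) ∧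
      IsPushout (CommRingCat.ofHom (algebraMap (QuotientRing k Γ) (UnitsRing k Γ)))
        (CommRingCat.ofHom ψ.toRingHom) (CommRingCat.ofHom φ.toRingHom)
        (CommRingCat.ofHom (algebraMap B A)) := by
  have : SMulCommClass Γ k A := ⟨fun σ a x => by
    rw [← algebraMap_smul B a x, smul_comm, algebraMap_smul]⟩
  let φ := unitsLift (k := k) (orbitElement Γ w) hw
  have hφ : ∀ (σ : Γ) x, φ (σ • x) = σ • φ x := unitsLift_orbitElement_smul hw
  let j := IsScalarTower.toAlgHom k B A
  let e : B ≃ₐ[k] j.range := AlgEquiv.ofInjective j hB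
  have hrange (x : QuotientRing k Γ) : φ x ∈ j.range := by
    obtain ⟨b, hb⟩ := Algebra.IsInvariant.isInvariant (A := B) (G := Γ) (φ x) fun σ => by
      rw [← hφ, x.2 σ]
    exact ⟨b, hb⟩
  let ψ : QuotientRing k Γ →ₐ[k] B := e.symm.toAlgHom.comp
    ((φ.comp (QuotientRing k Γ).val).codRestrict j.range hrange)
  have hψ (x : QuotientRing k Γ) : algebraMap B A (ψ x) = φ x :=
    congrArg Subtype.val (e.apply_symm_apply ⟨φ x, hrange x⟩)
  refine ⟨φ, ψ, hφ, ?_⟩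
  let : Algebra (QuotientRing k Γ) B := ψ.toRingHom.toAlgebra
  let : Algebra (UnitsRing k Γ) A := φ.toRingHom.toAlgebra
  have : IsScalarTower (QuotientRing k Γ) B A := .of_algebraMap_eq fun x => (hψ x).symm
  have hpush : Algebra.IsPushout (QuotientRing k Γ) B (UnitsRing k Γ) A := by
    refine isPushout_of_basis (unitsBasis k Γ) (orbitBasis hB hw) fun σ => ?_
    rw [orbitBasis_apply, unitsBasis_apply]
    refine (hφ σ _).trans (congrArg (σ • ·) ?_)
    refine (unitsLift_coord _ hw 1).trans ?_
    simp [orbitElement, coeff_groupElement]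
  exact (CommRingCat.isPushout_of_isPushout (QuotientRing k Γ) B (UnitsRing k Γ) A).flip

end Classifying

end AbelianCovering

namespace AbelianCovering

/-! ### Sections, density and fibres of a Galois covering. -/

section Covering

variable {V W : Scheme.{u}} (π : W ⟶ V) {Γ : Type u} [CommGroup Γ] (ρ : Γ →* Aut (Over.mk π))

/-- The functions on `π⁻¹(U)` as an algebra over the functions on `U`. -/
noncomputable abbrev sectionsAlgebra (U : V.Opens) : Algebra Γ(V, U) Γ(W, π ⁻¹ᵁ U) :=
  (π.app U).hom.toAlgebra

/-- The action of `Γ` on the functions on `π⁻¹(U)`. -/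
noncomputable abbrev sectionsAction (U : V.Opens) : MulSemiringAction Γ Γ(W, π ⁻¹ᵁ U) where
  smul σ s := autApp π (ρ σ) U s
  one_smul s := by
    change autApp π (ρ 1) U s = s
    rw [map_one, autApp_one]
  mul_smul σ τ s := by
    change autApp π (ρ (σ * τ)) U s = autApp π (ρ σ) U (autApp π (ρ τ) U s)
    rw [_root_.mul_comm, map_mul, autApp_mul]
  smul_zero σ := map_zero (autApp π (ρ σ) U)
  smul_add σ := map_add (autApp π (ρ σ) U)
  smul_one σ := map_one (autApp π (ρ σ) U)
  smul_mul σ := map_mul (autApp π (ρ σ) U)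

theorem smulCommClass_sections (U : V.Opens) :
    letI := sectionsAlgebra π U
    letI := sectionsAction π ρ U
    SMulCommClass Γ Γ(V, U) Γ(W, π ⁻¹ᵁ U) := by
  let := sectionsAlgebra π U
  let := sectionsAction π ρ U
  refine ⟨fun σ b a => ?_⟩
  change autApp π (ρ σ) U (π.app U b * a) = π.app U b * autApp π (ρ σ) U a
  rw [map_mul, autApp_app]

variable {π ρ}

theorem IsGaloisCovering.isInvariant_sections (h : IsGaloisCovering π ρ) (U : V.Opens) :
    letI := sectionsAlgebra π U
    letI := sectionsAction π ρ U
    Algebra.IsInvariant Γ(V, U) Γ(W, π ⁻¹ᵁ U) Γ := by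
  let := sectionsAlgebra π U
  let := sectionsAction π ρ U
  refine ⟨fun a ha => ?_⟩
  have : a ∈ Set.range (π.app U) := by
    rw [h.range_app]
    exact ha
  exact this

theorem IsGaloisCovering.eq_zero_of_app_mul_eq_zero (h : IsGaloisCovering π ρ) [IsIntegral V]
    [IsReduced W] (U : V.Opens) [Nonempty U] (s : Γ(V, U)) (a : Γ(W, π ⁻¹ᵁ U))
    (hsa : π.app U s * a = 0) : s = 0 ∨ a = 0 := by
  let := sectionsAlgebra π U
  let := sectionsAction π ρ U
  have := smulCommClass_sections π ρ U
  have := h.isInvariant_sections U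
  have := h.finite
  have := isTorsionFree_of_isInvariant Γ (h.injective_app U)
  exact smul_eq_zero.1 (show s • a = 0 from hsa)

/-- `W` may be reducible, so density rests on torsion freeness: if an open set of `W` missed
`π⁻¹(U)`, a nonzero function supported in it would be killed by a nonzero function on the base
supported in `U`. -/
theorem IsGaloisCovering.dense_preimage (h : IsGaloisCovering π ρ) [IsIntegral V]
    [IsReduced W] (U : V.Opens) [Nonempty U] : Dense ((π ⁻¹ᵁ U : W.Opens) : Set W) := by
  have := h.isAffineHom
  refine dense_iff_inter_open.2 fun O hO ⟨x, hx⟩ => ?_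
  obtain ⟨V₀, hV₀, hxV, -⟩ := exists_isAffineOpen_mem_and_subset (x := π x) (U := ⊤) trivial
  have : Nonempty V₀ := ⟨⟨_, hxV⟩⟩
  obtain ⟨a, ha, hxa⟩ := (hV₀.preimage π).exists_basicOpen_le (V := ⟨O, hO⟩) ⟨x, hx⟩ hxV
  obtain ⟨⟨y, hy⟩⟩ := ‹Nonempty U›
  obtain ⟨z, hzU, hzV⟩ := nonempty_preirreducible_inter U.isOpen V₀.isOpen ⟨y, hy⟩ ⟨_, hxV⟩
  obtain ⟨s, hs, hzs⟩ := hV₀.exists_basicOpen_le (V := U) ⟨z, hzU⟩ hzV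
  by_contra hempty
  have h0 : π.app V₀ s * a = 0 := by
    rw [← basicOpen_eq_bot_iff, Scheme.basicOpen_mul, ← Scheme.preimage_basicOpen,
      eq_bot_iff]
    intro t ht
    exact hempty ⟨t, ha ht.2, hs ht.1⟩
  obtain rfl | rfl := h.eq_zero_of_app_mul_eq_zero V₀ s a h0
  · rw [Scheme.basicOpen_zero] at hzs
    exact hzs
  · rw [Scheme.basicOpen_zero] at hxa
    exact hxa

theorem opens_comp_eq_of_appLE_eq_id {O : W.Opens} (hO : IsAffineOpen O) (f : W ⟶ W)
    (e : O ≤ f ⁻¹ᵁ O) (h : f.appLE O O e = 𝟙 _) : O.ι ≫ f = O.ι := by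
  have h2 := Scheme.Opens.toSpecΓ_SpecMap_appLE f O O e
  rw [h, Spec.map_id, Category.comp_id] at h2
  have : IsIso O.toSpecΓ := inferInstanceAs (IsIso hO.isoSpec.hom)
  have h3 : f.resLE O O e = 𝟙 _ := by
    rw [← cancel_mono O.toSpecΓ, Category.id_comp]
    exact h2.symm
  rw [← Scheme.Hom.resLE_comp_ι f e, h3, Category.id_comp]

/-- An automorphism trivial on the dense open `π⁻¹(U)` is trivial, since `W` is reduced and `π` is
separated. Faithfulness on `W` thus passes to sections over `U`. -/
theorem IsGaloisCovering.eq_one_of_autApp_eq (h : IsGaloisCovering π ρ) [IsIntegral V]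
    [IsReduced W] {U : V.Opens} [Nonempty U] (hU : IsAffineOpen U) (σ : Γ)
    (hσ : ∀ a, autApp π (ρ σ) U a = a) : σ = 1 := by
  have := h.isAffineHom
  refine h.faithful ?_
  rw [map_one]
  ext1
  ext1
  have : IsDominant (π ⁻¹ᵁ U).ι := ⟨by
    rw [DenseRange, Scheme.Opens.range_ι]
    exact h.dense_preimage U⟩
  have : IsReduced (Over.mk π).left := ‹IsReduced W›
  refine ext_of_isDominant_of_isSeparated π ?_ (π ⁻¹ᵁ U).ι ?_
  · exact (Over.w (ρ σ).hom).trans (Over.w (1 : Aut (Over.mk π)).hom).symm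
  · have h1 : (ρ σ).hom.left.appLE _ _ (preimage_le π (ρ σ) U) = 𝟙 _ := by
      ext a
      exact hσ a
    exact (opens_comp_eq_of_appLE_eq_id (W := W) (hU.preimage π) (ρ σ).hom.left
      (preimage_le π (ρ σ) U) h1).trans (Category.comp_id _).symm

theorem isReduced_of_isPullback {P X Y Z : Scheme.{u}} {fst : P ⟶ X} {snd : P ⟶ Y}
    {f : X ⟶ Z} {g : Y ⟶ Z} [IsIso g] [IsReduced X] (h : IsPullback fst snd f g) :
    IsReduced P := by
  have := h.isIso_fst_of_isIso
  exact isReduced_of_isOpenImmersion fst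

theorem isReduced_fiber_of_isPullback {P X Y Z : Scheme.{u}} {fst : P ⟶ X} {snd : P ⟶ Y}
    {f : X ⟶ Z} {g : Y ⟶ Z} [IsOpenImmersion g] (h : IsPullback fst snd f g) (y : Y)
    (hf : IsReduced (f.fiber (g y))) : IsReduced (snd.fiber y) := by
  have : IsReduced (pullback f (Z.fromSpecResidueField (g y))) := hf
  exact isReduced_of_isPullback (isPullback_fiberToSpecResidueField_of_isPullback h y)

theorem isRadical_map_primeIdealOf [IsAffineHom π] {U : V.Opens} (hU : IsAffineOpen U) (P : U)
    (hP : IsClosed {(P : V)}) (h : IsUnramifiedAt π P) :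
    ((hU.primeIdealOf P).asIdeal.map (π.app U).hom).IsRadical := by
  let := sectionsAlgebra π U
  have := hU.primeIdealOf_isMaximal_of_isClosed P hP
  refine isRadical_map_of_isReduced_fiber (B := Γ(V, U)) (A := Γ(W, π ⁻¹ᵁ U)) _ ?_
  have hpb : IsPullback (hU.preimage π).fromSpec (Spec.map (π.app U)) π hU.fromSpec := by
    refine (isPullback_morphismRestrict π U).flip.of_iso (hU.preimage π).isoSpec (Iso.refl _)
      hU.isoSpec (Iso.refl _) ?_ ?_ ?_ ?_
    · rw [IsAffineOpen.isoSpec_hom, IsAffineOpen.toSpecΓ_fromSpec, Iso.refl_hom, Category.comp_id]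
    · exact (Scheme.Opens.toSpecΓ_naturality π U).symm
    · rw [Iso.refl_hom, Iso.refl_hom, Category.comp_id, Category.id_comp]
    · rw [IsAffineOpen.isoSpec_hom, IsAffineOpen.toSpecΓ_fromSpec, Iso.refl_hom, Category.comp_id]
  have h1 : IsReduced ((Spec.map (π.app U)).fiber (hU.primeIdealOf P)) := by
    refine isReduced_fiber_of_isPullback hpb _ ?_
    rw [hU.fromSpec_primeIdealOf]
    exact h
  have e := AlgebraicGeometry.Spec.fiberToSpecResidueFieldIso Γ(V, U) Γ(W, π ⁻¹ᵁ U) (hU.primeIdealOf P)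
  have h4 : IsReduced (Spec (.of ((hU.primeIdealOf P).asIdeal.Fiber Γ(W, π ⁻¹ᵁ U)))) :=
    @isReduced_of_isOpenImmersion _ _ e.inv.left inferInstance h1
  exact (affine_isReduced_iff _).1 h4

end Covering

end AbelianCovering

namespace AbelianCovering

/-! ### A normal function near an unramified closed point. -/

section NormalElement

theorem isUnit_orbitElement_of_orbitDet_dvd {Γ A A' : Type*} [CommGroup Γ] [Fintype Γ]
    [DecidableEq Γ] [CommRing A] [CommRing A'] [MulSemiringAction Γ A] [MulSemiringAction Γ A']
    (r : A →+* A') (hr : ∀ (σ : Γ) a, r (σ • a) = σ • r a) (w N : A)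
    (hN : orbitDet (Γ := Γ) w ∣ N) (h : IsUnit (r N)) : IsUnit (orbitElement Γ (r w)) := by
  rw [isUnit_iff_isUnit_det_groupMatrix]
  have h1 : (groupMatrix (orbitElement Γ (r w)).coeff).det = r (orbitDet (Γ := Γ) w) := by
    rw [orbitDet, map_det_groupMatrix]
    congr 2
    ext σ
    simp [orbitElement, coeff_groupElement, hr]
  rw [h1]
  exact isUnit_of_dvd_unit (map_dvd r hN) h

variable {V W : Scheme.{u}}

theorem le_preimage_top (f : W ⟶ V) (O : W.Opens) : O ≤ f ⁻¹ᵁ ⊤ := le_top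

/-- The functions on an open subset of a `k`-scheme as a `k`-algebra. -/
noncomputable abbrev sectionsBaseAlgebra {k : Type u} [Field k] (s : V ⟶ Spec (.of k))
    (U : V.Opens) : Algebra k Γ(V, U) :=
  ((Scheme.ΓSpecIso (.of k)).inv ≫ s.appLE ⊤ U (le_preimage_top s U)).hom.toAlgebra

theorem finiteType_sectionsBaseAlgebra {k : Type u} [Field k] (s : V ⟶ Spec (.of k))
    [LocallyOfFiniteType s] {U : V.Opens} (hU : IsAffineOpen U) :
    letI := sectionsBaseAlgebra s U
    Algebra.FiniteType k Γ(V, U) := by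
  let := sectionsBaseAlgebra s U
  have h1 := s.finiteType_appLE (isAffineOpen_top _) hU (le_preimage_top s U)
  exact h1.comp (RingHom.FiniteType.of_surjective _
    (ConcreteCategory.bijective_of_isIso (Scheme.ΓSpecIso (.of k)).inv).2)

variable {π : W ⟶ V} {Γ : Type u} [CommGroup Γ] [Fintype Γ] [DecidableEq Γ]
  {ρ : Γ →* Aut (Over.mk π)}

/-- Near an unramified closed point there is a function on the covering whose conjugates form
a basis over the functions on the base. -/
theorem IsGaloisCovering.exists_isUnit_orbitElement (h : IsGaloisCovering π ρ) [IsIntegral V]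
    [IsReduced W] {k : Type u} [Field k] [PerfectField k] (s : V ⟶ Spec (.of k))
    [LocallyOfFiniteType s] [LocallyOfFiniteType π] (P : V) (hP : IsClosed {P})
    (hur : IsUnramifiedAt π P) :
    ∃ U : V.Opens, IsAffineOpen U ∧ P ∈ U ∧ ∃ w : Γ(W, π ⁻¹ᵁ U),
      letI := sectionsAction π ρ U
      IsUnit (orbitElement Γ w) := by
  have := h.isAffineHom
  obtain ⟨U, hU, hPU, -⟩ := exists_isAffineOpen_mem_and_subset (x := P) (U := ⊤) trivial
  have : Nonempty U := ⟨⟨P, hPU⟩⟩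
  let := sectionsAlgebra π U
  let := sectionsAction π ρ U
  let := sectionsBaseAlgebra s U
  have := smulCommClass_sections π ρ U
  have := h.isInvariant_sections U
  have : Algebra.FiniteType k Γ(V, U) := finiteType_sectionsBaseAlgebra s hU
  have : Algebra.FiniteType Γ(V, U) Γ(W, π ⁻¹ᵁ U) := by
    have := π.finiteType_appLE hU (hU.preimage π) le_rfl
    rwa [Scheme.Hom.appLE_eq_app] at this
  have : Algebra.IsIntegral Γ(V, U) Γ(W, π ⁻¹ᵁ U) := Algebra.IsInvariant.isIntegral _ _ Γ
  have : Module.Finite Γ(V, U) Γ(W, π ⁻¹ᵁ U) := Algebra.IsIntegral.finite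
  have : FaithfulSMul Γ Γ(W, π ⁻¹ᵁ U) := ⟨fun {σ τ} hστ => by
    rw [← inv_mul_eq_one]
    refine h.eq_one_of_autApp_eq hU _ fun a => ?_
    change (σ⁻¹ * τ) • a = a
    rw [mul_smul, ← hστ, inv_smul_smul]⟩
  have := hU.primeIdealOf_isMaximal_of_isClosed ⟨P, hPU⟩ hP
  obtain ⟨w, N, hN, hw⟩ := exists_orbitDet_dvd_of_isRadical (k := k) (Γ := Γ) (h.injective_app U)
    (hU.primeIdealOf ⟨P, hPU⟩).asIdeal (isRadical_map_primeIdealOf hU ⟨P, hPU⟩ hP hur)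
  -- Where `N` is invertible, so is the orbit determinant that divides it.
  refine ⟨V.basicOpen N, hU.basicOpen N, ?_,
    W.presheaf.map (homOfLE (π.preimage_mono (V.basicOpen_le N))).op w, ?_⟩
  · have h1 : hU.primeIdealOf ⟨P, hPU⟩ ∈ hU.fromSpec ⁻¹ᵁ V.basicOpen N := by
      rw [hU.fromSpec_preimage_basicOpen]
      exact hN
    have h2 : hU.fromSpec (hU.primeIdealOf ⟨P, hPU⟩) ∈ V.basicOpen N := h1
    rwa [hU.fromSpec_primeIdealOf] at h2
  · let := sectionsAction π ρ (V.basicOpen N)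
    refine isUnit_orbitElement_of_orbitDet_dvd
      (W.presheaf.map (homOfLE (π.preimage_mono (V.basicOpen_le N))).op).hom
      (fun σ a => (autApp_map π (ρ σ) (V.basicOpen_le N) a).symm) w (π.app U N) hw ?_
    have h1 : IsUnit (V.presheaf.map (homOfLE (V.basicOpen_le N)).op N) :=
      RingedSpace.isUnit_res_basicOpen _ N
    have h2 := h1.map (π.app (V.basicOpen N)).hom
    rwa [show (π.app (V.basicOpen N)).hom _ = _ from app_map π (V.basicOpen_le N) N] at h2

end NormalElement

end AbelianCovering

namespace AbelianCovering

/-! ### The pullback square, and the theorem. -/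

section Pullback

variable {V W : Scheme.{u}}

theorem toSpecΓ_specMap_algebraMap {k : Type u} [Field k] (s : V ⟶ Spec (.of k)) (U : V.Opens) :
    letI := sectionsBaseAlgebra s U
    U.toSpecΓ ≫ Spec.map (CommRingCat.ofHom (algebraMap k Γ(V, U))) = U.ι ≫ s := by
  let := sectionsBaseAlgebra s U
  have h : CommRingCat.ofHom (algebraMap k Γ(V, U)) =
    (Scheme.ΓSpecIso (.of k)).inv ≫ s.appLE ⊤ U (le_preimage_top s U) := rfl
  rw [h, Spec.map_comp, Scheme.Opens.toSpecΓ_SpecMap_appLE_assoc, Scheme.Opens.toSpecΓ_top,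
    Category.assoc, toSpecΓ_SpecMap_ΓSpecIso_inv, Category.comp_id, Scheme.Hom.resLE_comp_ι]

variable {π : W ⟶ V} {Γ : Type u} [CommGroup Γ] [Fintype Γ] [DecidableEq Γ]
  {ρ : Γ →* Aut (Over.mk π)}

theorem isScalarTower_sections {k : Type u} [Field k] (s : V ⟶ Spec (.of k)) (U : V.Opens) :
    letI := sectionsAlgebra π U
    letI := sectionsBaseAlgebra s U
    letI := sectionsBaseAlgebra (π ≫ s) (π ⁻¹ᵁ U)
    IsScalarTower k Γ(V, U) Γ(W, π ⁻¹ᵁ U) := by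
  let := sectionsAlgebra π U
  let := sectionsBaseAlgebra s U
  let := sectionsBaseAlgebra (π ≫ s) (π ⁻¹ᵁ U)
  refine .of_algebraMap_eq' ?_
  have h : (π ≫ s).appLE ⊤ (π ⁻¹ᵁ U) (le_preimage_top _ _) = s.appLE ⊤ U (le_preimage_top s U) ≫ π.app U := by
    rw [Scheme.Hom.app_eq_appLE, Scheme.Hom.appLE_comp_appLE]
  change ((Scheme.ΓSpecIso (.of k)).inv ≫ (π ≫ s).appLE ⊤ (π ⁻¹ᵁ U) (le_preimage_top _ _)).hom = _
  rw [h, ← Category.assoc]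
  rfl

theorem IsGaloisCovering.exists_isPullback (h : IsGaloisCovering π ρ) {k : Type u} [Field k]
    (s : V ⟶ Spec (.of k)) {U : V.Opens} (hU : IsAffineOpen U) (w : Γ(W, π ⁻¹ᵁ U))
    (hw : letI := sectionsAction π ρ U; IsUnit (orbitElement Γ w)) :
    ∃ (fU : U.toScheme ⟶ (QuotientGroup k Γ).left)
      (gU : (π ⁻¹ᵁ U).toScheme ⟶ (UnitsGroup k Γ).left),
      fU ≫ (QuotientGroup k Γ).hom = U.ι ≫ s ∧
      gU ≫ (UnitsGroup k Γ).hom = (π ⁻¹ᵁ U).ι ≫ π ≫ s ∧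
      (∀ σ : Γ, (ρ σ).hom.left.resLE (π ⁻¹ᵁ U) (π ⁻¹ᵁ U) (preimage_le π (ρ σ) U) ≫ gU =
        gU ≫ (specAction (QuotientRing k Γ) (UnitsRing k Γ) Γ σ).hom.left) ∧
      IsPullback gU (π ∣_ U) (quotientHom k Γ).left fU := by
  have := h.isAffineHom
  let := sectionsAlgebra π U
  let := sectionsAction π ρ U
  let := sectionsBaseAlgebra s U
  let := sectionsBaseAlgebra (π ≫ s) (π ⁻¹ᵁ U)
  have := smulCommClass_sections π ρ U
  have := h.isInvariant_sections U
  have := isScalarTower_sections (π := π) s U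
  obtain ⟨φ, ψ, hφ, hpush⟩ := exists_isPushout_unitsRing (k := k) (h.injective_app U) hw
  refine ⟨U.toSpecΓ ≫ Spec.map (CommRingCat.ofHom ψ.toRingHom),
    (π ⁻¹ᵁ U).toSpecΓ ≫ Spec.map (CommRingCat.ofHom φ.toRingHom), ?_, ?_, fun σ => ?_, ?_⟩
  · rw [← toSpecΓ_specMap_algebraMap s U]
    refine (Category.assoc _ _ _).trans ?_
    refine congrArg (U.toSpecΓ ≫ ·) ((Spec.map_comp _ _).symm.trans (congrArg Spec.map ?_))
    ext x
    exact ψ.commutes x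
  · rw [← toSpecΓ_specMap_algebraMap (π ≫ s) (π ⁻¹ᵁ U)]
    refine (Category.assoc _ _ _).trans ?_
    refine congrArg ((π ⁻¹ᵁ U).toSpecΓ ≫ ·)
      ((Spec.map_comp _ _).symm.trans (congrArg Spec.map ?_))
    ext x
    exact φ.commutes x
  · have h1 := Scheme.Opens.toSpecΓ_SpecMap_appLE (ρ σ).hom.left _ _ (preimage_le π (ρ σ) U)
    have h2 : Spec.map ((ρ σ).hom.left.appLE _ _ (preimage_le π (ρ σ) U)) ≫
        Spec.map (CommRingCat.ofHom φ.toRingHom) = Spec.map (CommRingCat.ofHom φ.toRingHom) ≫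
          (specAction (QuotientRing k Γ) (UnitsRing k Γ) Γ σ).hom.left := by
      refine (Spec.map_comp _ _).symm.trans ((congrArg Spec.map ?_).trans (Spec.map_comp _ _))
      ext x
      exact (hφ σ x).symm
    refine (Category.assoc _ _ _).symm.trans ((congrArg (· ≫ _) h1.symm).trans ?_)
    refine (Category.assoc _ _ _).trans ((congrArg (_ ≫ ·) h2).trans ?_)
    exact (Category.assoc _ _ _).symm
  · have h1 : IsIso U.toSpecΓ := inferInstanceAs (IsIso hU.isoSpec.hom)
    have h2 : IsIso (π ⁻¹ᵁ U).toSpecΓ := inferInstanceAs (IsIso (hU.preimage π).isoSpec.hom)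
    have h3 : IsPullback (π ⁻¹ᵁ U).toSpecΓ (π ∣_ U) (Spec.map (π.app U)) U.toSpecΓ :=
      .of_horiz_isIso ⟨Scheme.Opens.toSpecΓ_naturality π U⟩
    -- Affineness identifies `π` over `U` with a map of spectra; the pushout of rings supplies the
    -- other square.
    exact h3.paste_horiz (isPullback_SpecMap_of_isPushout _ _ _ _ hpush)

end Pullback

end AbelianCovering

theorem mainTheorem8 {k : Type u} [Field k] [PerfectField k]
    (V W : Over (Spec (.of k))) (hV : AbelianCovering.IsVariety V) (hVirr : IrreducibleSpace V.left)
    (hW : AbelianCovering.IsVariety W) (π : W ⟶ V)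
    (Γ : Type u) [CommGroup Γ] (ρ : Γ →* Aut (Over.mk π.left))
    (hπ : AbelianCovering.IsGaloisCovering π.left ρ) :
    ∃ (G' G : Over (Spec (.of k))) (_ : GrpObj G') (_ : GrpObj G) (h : G' ⟶ G)
      (ρ' : Γ →* Aut (Over.mk h.left)), AbelianCovering.IsAbelianIsogeny h ρ' ∧
      ∀ P : V.left, IsClosed {P} → AbelianCovering.IsUnramifiedAt π.left P →
        ∃ (f : V.left ⤏ G.left) (g : W.left ⤏ G'.left),
          f.IsOver (Spec (.of k)) ∧ g.IsOver (Spec (.of k)) ∧ P ∈ f.domain ∧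
          ∃ U : V.left.Opens, P ∈ U ∧
            AbelianCovering.IsPullbackOver π.left h.left ρ ρ' g f U := by
  classical
  have := hV.isReduced
  have := hV.locallyOfFiniteType
  have := hW.isReduced
  have := hW.locallyOfFiniteType
  have := hπ.finite
  let := Fintype.ofFinite Γ
  have : IsIntegral V.left := isIntegral_of_irreducibleSpace_of_isReduced _
  have : LocallyOfFiniteType (π.left ≫ V.hom) := by rwa [Over.w π]
  have : LocallyOfFiniteType π.left := locallyOfFiniteType_of_comp π.left V.hom
  refine ⟨AbelianCovering.UnitsGroup k Γ, AbelianCovering.QuotientGroup k Γ, inferInstance,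
    inferInstance, AbelianCovering.quotientHom k Γ, AbelianCovering.specAction _ _ Γ,
    AbelianCovering.isAbelianIsogeny_quotientHom k Γ, fun P hP hur => ?_⟩
  obtain ⟨U, hU, hPU, w, hw⟩ := hπ.exists_isUnit_orbitElement V.hom P hP hur
  have : Nonempty U := ⟨⟨P, hPU⟩⟩
  obtain ⟨fU, gU, hfU, hgU, hequiv, hpb⟩ := hπ.exists_isPullback V.hom hU w hw
  have hd : Dense (U : Set V.left) := U.isOpen.dense ⟨P, hPU⟩
  have hd' : Dense ((π.left ⁻¹ᵁ U : W.left.Opens) : Set W.left) := hπ.dense_preimage U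
  let F := Scheme.PartialMap.mk U hd fU
  let G := Scheme.PartialMap.mk (π.left ⁻¹ᵁ U) hd' gU
  have hF : F.IsOver (Spec (.of k)) := ⟨hfU⟩
  have hG : G.IsOver (Spec (.of k)) :=
    ⟨hgU.trans (congrArg ((π.left ⁻¹ᵁ U).ι ≫ ·) (Over.w π))⟩
  exact ⟨F.toRationalMap, G.toRationalMap, ⟨F, hF, rfl⟩, ⟨G, hG, rfl⟩,
    F.le_domain_toRationalMap hPU, U, hPU, hd, hd', fU, gU, rfl, rfl, hequiv, hpb⟩
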